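/- Let $\mathbb{T}$ be the circle with the normalized Lebesgue measure $\nu$. For a set of integers $\Lambda$, its two-sided density is $$\operatorname{dens}\Lambda=\lim_{n\to\infty}\frac{|\Lambda\cap[-n,n]|}{2n},$$ when this limit exists. For $f\in L_2(\mathbb{T})$ (complex-valued) and a Lebesgue measurable set $B\subset\mathbb{T}$ with $\nu(B)>0$ put $$\|f\|_{L_2(\mathbb{T})}=\Big(\int_{\mathbb{T}}|f|^2\,d\nu\Big)^{1/2},\qquad \|f\|_{L_2(B)}=\Big(\frac1{\nu(B)}\int_B|f|^2\,d\nu\Big)^{1/2}.$$ **Theorem (harmonic density).** For every $\varepsilon>0$ there are constants $c_1(\varepsilon),c_2(\varepsilon)>0$, depending only on $\varepsilon$, such that for every Lebesgue measurable set $B\subset\mathbb{T}$ of positive measure there exists a set of integers $\Lambda$ whose two-sided density exists and satisfies $$\operatorname{dens}\Lambda>(1-\varepsilon)\,\nu(B),$$ and such that $$c_1(\varepsilon)\,\|f\|_{L_2(\mathbb{T})}\le\|f\|_{L_2(B)}\le c_2(\varepsilon)\,\|f\|_{L_2(\mathbb{T})}$$ for every $f\in L_2(\mathbb{T})$ whose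 Fourier transform is supported by $\Lambda$, i.e. $\hat f(k)=0$ for all integers $k\notin\Lambda$. -/

import Mathlib

open MeasureTheory Filter Topology

noncomputable section

/-- The normalized Lebesgue (Haar) probability measure `ν` on the circle `𝕋`, realized as `ℝ ⧸ ℤ`
(identified with the unit circle by `t ↦ exp (2 π i t)`). -/
abbrev circleMeasure : Measure UnitAddCircle := AddCircle.haarAddCircle

/-- `‖f‖_{L₂(𝕋)} = (∫_𝕋 |f|² dν)^{1/2}`. -/
def normL2Circle (f : UnitAddCircle → ℂ) : ℝ :=
  Real.sqrt (∫ t, ‖f t‖ ^ 2 ∂circleMeasure)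

/-- `‖f‖_{L₂(B)} = (ν(B)⁻¹ ∫_B |f|² dν)^{1/2}`. -/
def normL2On (B : Set UnitAddCircle) (f : UnitAddCircle → ℂ) : ℝ :=
  Real.sqrt (1 / circleMeasure.real B * ∫ t in B, ‖f t‖ ^ 2 ∂circleMeasure)

/-- The set of integers `Λ` has two-sided density `d`:
the limit of `|Λ ∩ [-n, n]| / (2 n)` exists and equals `d`. -/
def HasTwoSidedDensity (Λ : Set ℤ) (d : ℝ) : Prop :=
  Tendsto (fun n : ℕ => ((Λ ∩ Set.Icc (-(n : ℤ)) (n : ℤ)).ncard : ℝ) / (2 * (n : ℝ)))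
    atTop (𝓝 d)

/-- The Fourier transform of `f` is supported by `Λ`: `f̂(k) = 0` for every integer `k ∉ Λ`. -/
def FourierSupportedBy (f : UnitAddCircle → ℂ) (Λ : Set ℤ) : Prop :=
  ∀ k : ℤ, k ∉ Λ → fourierCoeff f k = 0

end

/-! ### Resolvent identities in a ring. -/

section ResolventIdentities

variable {A : Type*} [Ring A] [Algebra ℝ A] {D G H X Y Z W : A}

/-! Write ν = ν(B). The Gram matrix of the exponentials 0, …, N-1 in L₂(B), divided by ν, is a
positive semidefinite G with unit diagonal and νG ≤ 1, since restriction to B is a contraction. The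
finite problem is thus a two-sided restricted invertibility statement: find at least (1-ε)νN
coordinates on which G is bounded above and below by constants in ε alone
(`exists_two_sided_selection`).

This is done by the barrier method. If P projects onto the chosen coordinates, P - tG⁻¹ is congruent
to G^{1/2}PG^{1/2} - t, and choosing i adds a rank-one term to P. The potentials are -tr (P -
tG⁻¹)⁻¹ at a lower barrier b, which falls slightly at each step, and at an upper barrier u, which
rises slightly. An averaging argument shows that more indices are admissible for the lower barrier
than are inadmissible for the upper one, so some index serves both and neither potential
deteriorates (`BarrierState.exists_insert`).

To pass to ℤ, note that the sets of frequencies with given comparison constants form a hereditary,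
translation invariant family determined by finite subsets. Fekete's lemma gives its maximal density
d, which is at least (1-ε)ν. A set extremal on a long interval may still be unevenly spread, so a
rising sun argument finds a centre from which the windows on both sides, at many scales, have
density close to d. An ultrafilter limit of the recentred sets stays in the family; its counts on
[-n, n] are squeezed to density d, because no window can beat the maximal count
(`exists_hasTwoSidedDensity`). Convergence of Fourier series in L₂ then extends the estimates from
trigonometric polynomials to all f. -/

theorem compression_sub_smul_eq (hGH : G * H = 1) (hHG : H * G = 1) (b : ℝ)
    (hX : X = D - b • H) (hXZ : X * Z = 1) :
    D * G * D - b • D = X * (b • Z + G) * X := by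
  have h1 : X * (b • Z + G) * X = b • X + X * G * X := by
    rw [mul_add, mul_smul_comm, hXZ, add_mul, smul_mul_assoc, one_mul]
  have h3 : ∀ x, H * (G * x) = x := fun x => by rw [← mul_assoc, hHG, one_mul]
  rw [h1, hX]
  simp only [sub_mul, mul_sub, smul_mul_assoc, mul_smul_comm, mul_assoc, hGH, h3, mul_one]
  module

/-- Congruence by the invertible X exchanges DGD - bD with bZ + G. With D a coordinate projection
and H = G⁻¹, the barrier condition DGD ≥ bD thus becomes positivity of an expression in the
resolvent Z. -/
theorem smul_resolvent_add_eq (hGH : G * H = 1) (hHG : H * G = 1) (b : ℝ)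
    (hX : X = D - b • H) (hXZ : X * Z = 1) (hZX : Z * X = 1) :
    b • Z + G = Z * (D * G * D - b • D) * Z := by
  rw [compression_sub_smul_eq hGH hHG b hX hXZ, ← mul_assoc, ← mul_assoc, hZX, one_mul, mul_assoc,
    hXZ, mul_one]

theorem compression_resolvent_eq (hGH : G * H = 1) (b : ℝ)
    (hX : X = D - b • H) (hXZ : X * Z = 1) (hZX : Z * X = 1) :
    D * Z * D = D + b • (H * (b • Z + G) * H) := by
  have hDZ : D * Z = 1 + b • (H * Z) := by
    have : D = X + b • H := by rw [hX]; abel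
    rw [this, add_mul, hXZ, smul_mul_assoc]
  have hZD : Z * D = 1 + b • (Z * H) := by
    have : D = X + b • H := by rw [hX]; abel
    rw [this, mul_add, hZX, mul_smul_comm]
  have h1 : D * Z * D = D + b • (H * (Z * D)) := by
    rw [hDZ, add_mul, one_mul, smul_mul_assoc, mul_assoc]
  rw [h1, hZD]
  simp only [add_mul, mul_add, smul_mul_assoc, mul_smul_comm, mul_assoc, hGH, mul_one]
  module

/-- The resolvent identity is used twice so that W stands on both sides. A lower bound for the
middle factor then bounds the change of the trace by a multiple of tr W². -/
theorem resolvent_sub_eq (s t : ℝ) (hX : X = D - s • H) (hY : Y = D - t • H)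
    (hXZ : X * Z = 1) (hZX : Z * X = 1) (hYW : Y * W = 1) (hWY : W * Y = 1) :
    Z - W = (s - t) • (W * (H + (s - t) • (H * Z * H)) * W) := by
  have hYX : Y - X = (s - t) • H := by rw [hX, hY]; module
  have h1 : Z - W = (s - t) • (Z * H * W) := by
    have : Z * (Y - X) * W = Z - W := by
      rw [mul_sub, sub_mul, mul_assoc, hYW, hZX, mul_one, one_mul]
    rw [← this, hYX, mul_smul_comm, smul_mul_assoc]
  have h2 : Z - W = (s - t) • (W * H * Z) := by
    have : W * (Y - X) * Z = Z - W := by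
      rw [mul_sub, sub_mul, mul_assoc W X, hXZ, hWY, mul_one, one_mul]
    rw [← this, hYX, mul_smul_comm, smul_mul_assoc]
  have h3 : Z = W + (s - t) • (W * H * Z) := by rw [← h2]; abel
  rw [h1]
  conv_lhs => rw [h3]
  simp only [add_mul, mul_add, smul_mul_assoc, mul_smul_comm, mul_assoc]

end ResolventIdentities

/-! ### Coordinate projections and rank-one updates. -/

section MatrixBarrier

open scoped ComplexOrder

variable {n : Type*} [DecidableEq n]

open Matrix

/-- The coordinate projection onto the coordinates in `σ`. -/
noncomputable def coordProj (σ : Finset n) : Matrix n n ℂ :=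
  Matrix.diagonal fun i => if i ∈ σ then 1 else 0

theorem coordProj_isHermitian (σ : Finset n) : (coordProj σ).IsHermitian := by
  apply Matrix.isHermitian_diagonal_of_self_adjoint
  ext i
  by_cases h : i ∈ σ <;> simp [h]

theorem coordProj_insert {σ : Finset n} {i : n} (hi : i ∉ σ) :
    coordProj (insert i σ) = coordProj σ + Matrix.single i i 1 := by
  ext j k
  by_cases hjk : j = k
  · subst hjk
    by_cases hij : i = j
    · subst hij; simp [coordProj, hi]
    · have : j ≠ i := fun h => hij h.symm
      simp [coordProj, hij, this]
  · simp only [coordProj, Matrix.diagonal_apply_ne _ hjk, Matrix.add_apply, zero_add]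
    rw [Matrix.single_apply_of_ne]
    rintro ⟨rfl, rfl⟩; exact hjk rfl

variable [Fintype n]

theorem coordProj_mul_self (σ : Finset n) : coordProj σ * coordProj σ = coordProj σ := by
  simp [coordProj]

theorem coordProj_mulVec_apply (σ : Finset n) (x : n → ℂ) (i : n) :
    (coordProj σ *ᵥ x) i = if i ∈ σ then x i else 0 := by
  simp [coordProj, Matrix.mulVec_diagonal]

/-- Rank one update of an inverse. -/
theorem add_single_mul_eq_one {X Z : Matrix n n ℂ} (hXZ : X * Z = 1) (i : n)
    (h : 1 + Z i i ≠ 0) :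
    (X + Matrix.single i i 1) * (Z - (1 + Z i i)⁻¹ • (Z * Matrix.single i i 1 * Z)) = 1 := by
  have h1 : Matrix.single i i (1 : ℂ) * Z * Matrix.single i i 1 = Z i i • Matrix.single i i 1 := by
    simp
  have h2 : (X + Matrix.single i i 1) * (Z * Matrix.single i i 1 * Z) =
      (1 + Z i i) • (Matrix.single i i (1 : ℂ) * Z) := by
    rw [add_mul, ← mul_assoc, ← mul_assoc, hXZ, one_mul, ← mul_assoc, ← mul_assoc, h1, add_smul,
      one_smul, smul_mul_assoc]
  rw [mul_sub, mul_smul_comm, h2, smul_smul, inv_mul_cancel₀ h, one_smul, add_mul, hXZ]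
  abel

theorem trace_mul_single_mul (Z : Matrix n n ℂ) (i : n) :
    (Z * Matrix.single i i 1 * Z).trace = (Z * Z) i i := by
  rw [Matrix.trace_mul_comm, ← mul_assoc, Matrix.trace_mul_comm, Matrix.trace_single_mul]
  simp

theorem posSemidef_mul_single_mul {Z : Matrix n n ℂ} (hZ : Z.IsHermitian) (i : n) :
    (Z * Matrix.single i i 1 * Z).PosSemidef := by
  have h : (Matrix.single i i (1 : ℂ)).PosSemidef := by
    rw [← Matrix.diagonal_single]
    apply Matrix.PosSemidef.diagonal
    exact Pi.single_nonneg.2 zero_le_one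
  have := h.mul_mul_conjTranspose_same Z
  rwa [hZ.eq] at this

end MatrixBarrier

/-! ### Averaging over the candidate indices. -/

section Counting

variable {ι : Type*} [Fintype ι]

/-- An index outside the filter has p i ≤ 1 + q i / (κ ∑ q), and these excesses add up to at most
1/κ; an index in the filter contributes at most M more. -/
theorem le_card_add_of_lower_barrier (p q : ι → ℝ) {κ Δ T M : ℝ} (hq : ∀ i, 0 ≤ q i) (hκ : 0 < κ)
    (hΔ : κ * ∑ i, q i ≤ Δ) (hT : T ≤ ∑ i, p i) (hM : ∀ i, p i ≤ M) :
    T ≤ Fintype.card ι + 1 / κ +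
      M * ((Finset.univ.filter fun i => 1 < p i ∧ q i ≤ (p i - 1) * Δ).card : ℝ) := by
  classical
  have hQ : 0 ≤ ∑ i, q i := Finset.sum_nonneg fun i _ => hq i
  have key : ∀ i, p i ≤ 1 + q i / (κ * ∑ i, q i) +
      if 1 < p i ∧ q i ≤ (p i - 1) * Δ then M else 0 := by
    intro i
    have h0 : 0 ≤ q i / (κ * ∑ i, q i) := by have := hq i; positivity
    split_ifs with h
    · linarith [hM i]
    · by_cases hp : 1 < p i
      · have h1 : (p i - 1) * Δ < q i := by
          by_contra hc; exact h ⟨hp, not_lt.1 hc⟩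
        have h2 : (p i - 1) * (κ * ∑ i, q i) < q i :=
          lt_of_le_of_lt (mul_le_mul_of_nonneg_left hΔ (by linarith)) h1
        have h3 : 0 < q i := lt_of_le_of_lt (mul_nonneg (by linarith) (by positivity)) h2
        have h4 : 0 < ∑ i, q i :=
          lt_of_lt_of_le h3 (Finset.single_le_sum (fun i _ => hq i) (Finset.mem_univ i))
        have h5 : p i - 1 ≤ q i / (κ * ∑ i, q i) := by
          rw [le_div_iff₀ (by positivity)]; exact h2.le
        linarith
      · linarith [not_lt.1 hp]
  have hs := Finset.sum_le_sum fun i (_ : i ∈ Finset.univ) => key i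
  rw [Finset.sum_add_distrib, Finset.sum_add_distrib, ← Finset.sum_div, ← Finset.sum_filter,
    Finset.sum_const, Finset.sum_const, nsmul_eq_mul, nsmul_eq_mul, mul_one, Finset.card_univ] at hs
  -- If all `q i` vanish, the left side is the default value 0 of division by zero.
  have h6 : (∑ i, q i) / (κ * ∑ i, q i) ≤ 1 / κ := by
    rcases hQ.eq_or_lt with h | h
    · rw [← h]; simp [hκ.le]
    · apply le_of_eq; field_simp
  linarith

/-- Dual count: each inadmissible index satisfies 1 ≤ r i + q i / (κ ∑ q), and this is summed. -/
theorem card_le_of_upper_barrier (r q : ι → ℝ) {κ Δ : ℝ} (hr : ∀ i, 0 ≤ r i) (hq : ∀ i, 0 ≤ q i)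
    (hκ : 0 < κ) (hΔ : κ * ∑ i, q i ≤ Δ) :
    ((Finset.univ.filter fun i => ¬ (r i < 1 ∧ q i ≤ (1 - r i) * Δ)).card : ℝ) ≤
      ∑ i, r i + 1 / κ := by
  classical
  have hQ : 0 ≤ ∑ i, q i := Finset.sum_nonneg fun i _ => hq i
  have key : ∀ i, (if ¬ (r i < 1 ∧ q i ≤ (1 - r i) * Δ) then (1 : ℝ) else 0) ≤
      r i + q i / (κ * ∑ i, q i) := by
    intro i
    have h0 : 0 ≤ q i / (κ * ∑ i, q i) := by have := hq i; positivity
    split_ifs with h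
    · linarith [hr i]
    · by_cases hp : r i < 1
      · have h1 : (1 - r i) * Δ < q i := by
          by_contra hc; exact h ⟨hp, not_lt.1 hc⟩
        have h2 : (1 - r i) * (κ * ∑ i, q i) < q i :=
          lt_of_le_of_lt (mul_le_mul_of_nonneg_left hΔ (by linarith)) h1
        have h3 : 0 < q i := lt_of_le_of_lt (mul_nonneg (by linarith) (by positivity)) h2
        have h4 : 0 < ∑ i, q i :=
          lt_of_lt_of_le h3 (Finset.single_le_sum (fun i _ => hq i) (Finset.mem_univ i))
        have h5 : 1 - r i ≤ q i / (κ * ∑ i, q i) := by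
          rw [le_div_iff₀ (by positivity)]; exact h2.le
        linarith
      · linarith [not_lt.1 hp]
  have hs := Finset.sum_le_sum fun i (_ : i ∈ Finset.univ) => key i
  rw [Finset.sum_add_distrib, ← Finset.sum_div, ← Finset.sum_filter,
    Finset.sum_const, nsmul_eq_mul, mul_one] at hs
  have h6 : (∑ i, q i) / (κ * ∑ i, q i) ≤ 1 / κ := by
    rcases hQ.eq_or_lt with h | h
    · rw [← h]; simp [hκ.le]
    · apply le_of_eq; field_simp
  linarith

end Counting

/-! ### Positivity facts and invertibility below the lower barrier. -/

section Barrier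

open scoped ComplexOrder
open Matrix

variable {n : Type*}

theorem Matrix.PosSemidef.re_trace_nonneg [Fintype n] {A : Matrix n n ℂ} (hA : A.PosSemidef) :
    0 ≤ A.trace.re := (Complex.le_def.1 hA.trace_nonneg).1

theorem Matrix.PosSemidef.re_diag_nonneg {A : Matrix n n ℂ} (hA : A.PosSemidef) (i : n) :
    0 ≤ (A i i).re := (Complex.le_def.1 (hA.diag_nonneg (i := i))).1

theorem Matrix.IsHermitian.ofReal_re_diag {A : Matrix n n ℂ} (hA : A.IsHermitian) (i : n) :
    ((A i i).re : ℂ) = A i i := hA.coe_re_apply_self i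

theorem Matrix.PosSemidef.mul_mul_self [Fintype n] {A B : Matrix n n ℂ} (hA : A.PosSemidef)
    (hB : B.IsHermitian) : (B * A * B).PosSemidef := by
  have := hA.mul_mul_conjTranspose_same B
  rwa [hB.eq] at this

theorem Matrix.IsHermitian.real_smul {A : Matrix n n ℂ} (hA : A.IsHermitian) (t : ℝ) :
    (t • A).IsHermitian := by
  rw [Matrix.IsHermitian, Matrix.conjTranspose_smul, hA.eq, star_trivial]

variable [Fintype n] [DecidableEq n] {G : Matrix n n ℂ}

theorem Matrix.PosDef.mul_inv_self (hG : G.PosDef) : G * G⁻¹ = 1 :=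
  Matrix.mul_nonsing_inv _ ((Matrix.isUnit_iff_isUnit_det _).1 hG.isUnit)

theorem Matrix.PosDef.inv_mul_self (hG : G.PosDef) : G⁻¹ * G = 1 :=
  Matrix.nonsing_inv_mul _ ((Matrix.isUnit_iff_isUnit_det _).1 hG.isUnit)

/-- If `ν G ≤ 1` then `G⁻¹ ≥ ν`. -/
theorem Matrix.PosDef.inv_sub_smul_posSemidef (hG : G.PosDef) {ν : ℝ} (hν : 0 ≤ ν)
    (h : (1 - ν • G).PosSemidef) : (G⁻¹ - ν • (1 : Matrix n n ℂ)).PosSemidef := by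
  have e : G⁻¹ - ν • (1 : Matrix n n ℂ) =
      (G⁻¹ - ν • (1 : Matrix n n ℂ)) * G * (G⁻¹ - ν • (1 : Matrix n n ℂ)) + ν • (1 - ν • G) := by
    simp only [sub_mul, mul_sub, smul_mul_assoc, mul_smul_comm, hG.mul_inv_self,
      hG.inv_mul_self, mul_one, one_mul]
    module
  have hH : (G⁻¹ - ν • (1 : Matrix n n ℂ)).IsHermitian :=
    hG.inv.isHermitian.sub (Matrix.isHermitian_one.real_smul ν)
  rw [e]
  exact (hG.posSemidef.mul_mul_self hH).add (h.smul hν)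

/-- A kernel vector y gives x = G⁻¹y in the range of the projection P with PGPx = b'x, which PGP ≥
bP forbids for b' < b unless x = 0. So the lower barrier may be moved down. -/
theorem isUnit_coordProj_sub (hG : G.PosDef) {σ : Finset n} {b b' : ℝ} (hb' : 0 < b') (hbb : b' < b)
    (h : (coordProj σ * G * coordProj σ - b • coordProj σ).PosSemidef) :
    IsUnit (coordProj σ - b' • G⁻¹) := by
  rw [Matrix.isUnit_iff_isUnit_det, isUnit_iff_ne_zero]
  intro hdet
  obtain ⟨y, hy0, hy⟩ := Matrix.exists_mulVec_eq_zero_iff.2 hdet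
  set D := coordProj σ with hD
  set x := G⁻¹ *ᵥ y with hx
  have hGx : G *ᵥ x = y := by rw [hx, Matrix.mulVec_mulVec, hG.mul_inv_self, Matrix.one_mulVec]
  have h1 : D *ᵥ y = b' • x := by
    rw [Matrix.sub_mulVec, Matrix.smul_mulVec, sub_eq_zero] at hy
    exact hy
  have hDx : D *ᵥ x = x := by
    have : b' • (D *ᵥ x) = b' • x := by
      rw [← Matrix.mulVec_smul, ← h1, Matrix.mulVec_mulVec, coordProj_mul_self]
    exact smul_right_injective _ hb'.ne' this
  have h2 := h.dotProduct_mulVec_nonneg x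
  have h3 : (D * G * D - b • D) *ᵥ x = (b' - b) • x := by
    rw [Matrix.sub_mulVec, Matrix.smul_mulVec, hDx, ← Matrix.mulVec_mulVec, hDx,
      ← Matrix.mulVec_mulVec, hGx, h1, sub_smul]
  rw [h3, dotProduct_smul] at h2
  have h4 : 0 ≤ star x ⬝ᵥ x := _root_.dotProduct_star_self_nonneg x
  have h5 : star x ⬝ᵥ x = 0 := by
    have h6 := (Complex.le_def.1 h2).1
    have h7 := Complex.le_def.1 h4
    simp only [Complex.real_smul, Complex.re_ofReal_mul, Complex.zero_re] at h6 h7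
    apply Complex.ext
    · simp only [Complex.zero_re]; nlinarith
    · exact h7.2.symm
  have hx0 : x = 0 := _root_.dotProduct_star_self_eq_zero.1 h5
  apply hy0
  rw [← hGx, hx0, Matrix.mulVec_zero]

end Barrier

/-! ### Effect of moving a barrier and of adding an index. -/

section BarrierStep

open scoped ComplexOrder
open Matrix

variable {n : Type*} [Fintype n] [DecidableEq n] {G : Matrix n n ℂ}

/-- The inverse of `P - t G⁻¹`, where `P` is the coordinate projection onto `σ`. -/
noncomputable def barrierResolvent (G : Matrix n n ℂ) (σ : Finset n) (t : ℝ) : Matrix n n ℂ :=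
  (coordProj σ - t • G⁻¹)⁻¹

theorem barrier_mul_resolvent {σ : Finset n} {t : ℝ} (h : IsUnit (coordProj σ - t • G⁻¹)) :
    (coordProj σ - t • G⁻¹) * barrierResolvent G σ t = 1 :=
  Matrix.mul_nonsing_inv _ ((Matrix.isUnit_iff_isUnit_det _).1 h)

theorem barrierResolvent_mul {σ : Finset n} {t : ℝ} (h : IsUnit (coordProj σ - t • G⁻¹)) :
    barrierResolvent G σ t * (coordProj σ - t • G⁻¹) = 1 :=
  Matrix.nonsing_inv_mul _ ((Matrix.isUnit_iff_isUnit_det _).1 h)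

theorem barrierResolvent_isHermitian (hG : G.PosDef) (σ : Finset n) (t : ℝ) :
    (barrierResolvent G σ t).IsHermitian :=
  ((coordProj_isHermitian σ).sub (hG.inv.isHermitian.real_smul t)).inv

theorem smul_resolvent_add_posSemidef (hG : G.PosDef) {σ : Finset n} {b : ℝ}
    (hu : IsUnit (coordProj σ - b • G⁻¹))
    (h : (coordProj σ * G * coordProj σ - b • coordProj σ).PosSemidef) :
    (b • barrierResolvent G σ b + G).PosSemidef := by
  rw [smul_resolvent_add_eq hG.mul_inv_self hG.inv_mul_self b rfl (barrier_mul_resolvent hu)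
    (barrierResolvent_mul hu)]
  exact h.mul_mul_self (barrierResolvent_isHermitian hG σ b)

theorem compression_posSemidef_of_resolvent (hG : G.PosDef) {σ : Finset n} {b : ℝ}
    (hu : IsUnit (coordProj σ - b • G⁻¹)) (h : (b • barrierResolvent G σ b + G).PosSemidef) :
    (coordProj σ * G * coordProj σ - b • coordProj σ).PosSemidef := by
  rw [compression_sub_smul_eq hG.mul_inv_self hG.inv_mul_self b rfl (barrier_mul_resolvent hu)]
  exact h.mul_mul_self ((coordProj_isHermitian σ).sub (hG.inv.isHermitian.real_smul b))

/-- `compression_resolvent_eq` writes PZP as P plus a positive semidefinite matrix. Since a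
candidate must have diagonal entry below -1, an index already chosen is never chosen again. -/
theorem one_le_re_resolvent_diag (hG : G.PosDef) {σ : Finset n} {b : ℝ} (hb : 0 ≤ b)
    (hu : IsUnit (coordProj σ - b • G⁻¹))
    (h : (b • barrierResolvent G σ b + G).PosSemidef) {i : n} (hi : i ∈ σ) :
    1 ≤ (barrierResolvent G σ b i i).re := by
  have e := compression_resolvent_eq hG.mul_inv_self b rfl (barrier_mul_resolvent hu)
    (barrierResolvent_mul hu)
  have e1 := congrArg (fun M : Matrix n n ℂ => (M i i).re) e
  have h1 := ((h.mul_mul_self hG.inv.isHermitian).smul hb).re_diag_nonneg i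
  have h2 : (coordProj σ * barrierResolvent G σ b * coordProj σ) i i =
      barrierResolvent G σ b i i := by
    simp [coordProj, hi]
  have h3 : coordProj σ i i = 1 := by simp [coordProj, hi]
  simp only [h2, Matrix.add_apply, h3, Complex.add_re, Complex.one_re] at e1
  linarith

theorem isUnit_barrier_insert {σ : Finset n} {t : ℝ} (hu : IsUnit (coordProj σ - t • G⁻¹)) {i : n}
    (hi : i ∉ σ) (h : 1 + barrierResolvent G σ t i i ≠ 0) :
    IsUnit (coordProj (insert i σ) - t • G⁻¹) ∧
      barrierResolvent G (insert i σ) t = barrierResolvent G σ t - (1 + barrierResolvent G σ t i i)⁻¹ •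
        (barrierResolvent G σ t * Matrix.single i i 1 * barrierResolvent G σ t) := by
  have h1 := add_single_mul_eq_one (barrier_mul_resolvent hu) i h
  have h2 : coordProj σ - t • G⁻¹ + Matrix.single i i 1 = coordProj (insert i σ) - t • G⁻¹ := by
    rw [coordProj_insert hi]; abel
  rw [h2] at h1
  exact ⟨(Matrix.isUnit_iff_isUnit_det _).2 (Matrix.isUnit_det_of_right_inverse h1),
    Matrix.inv_eq_right_inv h1⟩

theorem barrierResolvent_insert_real (hG : G.PosDef) {σ : Finset n} {t : ℝ}
    (hu : IsUnit (coordProj σ - t • G⁻¹)) {i : n}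
    (hi : i ∉ σ) (h : 1 + (barrierResolvent G σ t i i).re ≠ 0) :
    IsUnit (coordProj (insert i σ) - t • G⁻¹) ∧
      barrierResolvent G (insert i σ) t =
        barrierResolvent G σ t - (1 + (barrierResolvent G σ t i i).re)⁻¹ •
        (barrierResolvent G σ t * Matrix.single i i 1 * barrierResolvent G σ t) := by
  have hre := (barrierResolvent_isHermitian hG σ t).ofReal_re_diag i
  have hne : 1 + barrierResolvent G σ t i i ≠ 0 := by
    rw [← hre]; exact_mod_cast h
  refine ⟨(isUnit_barrier_insert hu hi hne).1, ?_⟩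
  rw [(isUnit_barrier_insert hu hi hne).2]
  congr 1
  conv_lhs => rw [← hre]
  ext j k
  simp

theorem re_trace_resolvent_insert (hG : G.PosDef) {σ : Finset n} {t : ℝ}
    (hu : IsUnit (coordProj σ - t • G⁻¹)) {i : n}
    (hi : i ∉ σ) (h : 1 + (barrierResolvent G σ t i i).re ≠ 0) :
    (barrierResolvent G (insert i σ) t).trace.re = (barrierResolvent G σ t).trace.re -
      ((barrierResolvent G σ t * barrierResolvent G σ t) i i).re /
        (1 + (barrierResolvent G σ t i i).re) := by
  rw [(barrierResolvent_insert_real hG hu hi h).2, Matrix.trace_sub, Matrix.trace_smul,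
    trace_mul_single_mul, Complex.sub_re, Complex.real_smul, Complex.re_ofReal_mul]
  ring

theorem resolvent_sq_posSemidef (hG : G.PosDef) (σ : Finset n) (t : ℝ) :
    (barrierResolvent G σ t * barrierResolvent G σ t).PosSemidef := by
  have := Matrix.posSemidef_self_mul_conjTranspose (barrierResolvent G σ t)
  rwa [(barrierResolvent_isHermitian hG σ t).eq] at this

/-- From bZ + G ≥ 0 follows G⁻¹ZG⁻¹ ≥ -G⁻¹/b, so the middle factor in `resolvent_sub_eq` is at least
(1 - δ/b)G⁻¹ ≥ (1 - δ/b)ν. -/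
theorem re_trace_resolvent_lower_shift (hG : G.PosDef) {σ : Finset n} {ν b δ : ℝ}
    (hν : (G⁻¹ - ν • (1 : Matrix n n ℂ)).PosSemidef) (hb : 0 < b) (hδ : 0 ≤ δ) (hδb : δ ≤ b)
    (hu : IsUnit (coordProj σ - b • G⁻¹)) (hu' : IsUnit (coordProj σ - (b - δ) • G⁻¹))
    (h : (b • barrierResolvent G σ b + G).PosSemidef) :
    δ * (1 - δ / b) * ν *
        (barrierResolvent G σ (b - δ) * barrierResolvent G σ (b - δ)).trace.re ≤
      (barrierResolvent G σ b).trace.re - (barrierResolvent G σ (b - δ)).trace.re := by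
  have e := resolvent_sub_eq b (b - δ) rfl rfl (barrier_mul_resolvent hu) (barrierResolvent_mul hu)
    (barrier_mul_resolvent hu') (barrierResolvent_mul hu')
  set Z := barrierResolvent G σ b
  set W := barrierResolvent G σ (b - δ)
  have hb1 : 0 ≤ 1 - δ / b := by
    rw [sub_nonneg, div_le_one hb]; exact hδb
  have hP : (W * ((1 - δ / b) • (G⁻¹ - ν • (1 : Matrix n n ℂ)) +
      (δ / b) • (G⁻¹ * (b • Z + G) * G⁻¹)) * W).PosSemidef := by
    apply PosSemidef.mul_mul_self _ (barrierResolvent_isHermitian hG σ (b - δ))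
    exact (hν.smul hb1).add ((h.mul_mul_self hG.inv.isHermitian).smul (by positivity))
  have e2 : Z - W = δ • (W * ((1 - δ / b) • (G⁻¹ - ν • (1 : Matrix n n ℂ)) +
      (δ / b) • (G⁻¹ * (b • Z + G) * G⁻¹)) * W) + (δ * (1 - δ / b) * ν) • (W * W) := by
    rw [e, sub_sub_cancel]
    have h5 : G⁻¹ * (b • Z + G) * G⁻¹ = b • (G⁻¹ * Z * G⁻¹) + G⁻¹ := by
      simp only [mul_add, add_mul, mul_smul_comm, smul_mul_assoc, hG.inv_mul_self, one_mul]
    have h6 : (1 - δ / b) • (G⁻¹ - ν • (1 : Matrix n n ℂ)) +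
      (δ / b) • (G⁻¹ * (b • Z + G) * G⁻¹) =
        (G⁻¹ + δ • (G⁻¹ * Z * G⁻¹)) - ((1 - δ / b) * ν) • (1 : Matrix n n ℂ) := by
      rw [h5]
      have : (δ / b) • b • (G⁻¹ * Z * G⁻¹) = δ • (G⁻¹ * Z * G⁻¹) := by
        rw [smul_smul, div_mul_cancel₀ _ hb.ne']
      rw [smul_add, this]
      module
    rw [h6, mul_sub, sub_mul, mul_smul_comm, smul_mul_assoc, mul_one]
    module
  have e3 := congrArg (fun M : Matrix n n ℂ => M.trace.re) e2
  have h0 := (hP.smul hδ).re_trace_nonneg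
  simp only [Matrix.trace_sub, Matrix.trace_add, Complex.sub_re, Complex.add_re] at e3
  rw [Matrix.trace_smul (δ * (1 - δ / b) * ν), Complex.real_smul, Complex.re_ofReal_mul] at e3
  linarith

theorem neg_resolvent_posDef {σ : Finset n} {u : ℝ} (h : (u • G⁻¹ - coordProj σ).PosDef) :
    IsUnit (coordProj σ - u • G⁻¹) ∧ (-barrierResolvent G σ u).PosDef := by
  have e : coordProj σ - u • G⁻¹ = -(u • G⁻¹ - coordProj σ) := by abel
  have h1 : IsUnit (coordProj σ - u • G⁻¹) := by rw [e]; exact h.isUnit.neg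
  refine ⟨h1, ?_⟩
  have : (u • G⁻¹ - coordProj σ)⁻¹ = -barrierResolvent G σ u := by
    apply Matrix.inv_eq_right_inv
    rw [mul_neg, ← neg_mul, ← e, barrier_mul_resolvent h1]
  rw [← this]
  exact h.inv

/-- Above the spectrum -Z is positive, so the middle factor in `resolvent_sub_eq` is at least G⁻¹ ≥
ν, with no loss factor. -/
theorem re_trace_resolvent_upper_shift (hG : G.PosDef) {σ : Finset n} {ν u δ : ℝ}
    (hν : (G⁻¹ - ν • (1 : Matrix n n ℂ)).PosSemidef) (hδ : 0 ≤ δ)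
    (hu : (u • G⁻¹ - coordProj σ).PosDef) (hu' : ((u + δ) • G⁻¹ - coordProj σ).PosDef) :
    δ * ν * (barrierResolvent G σ (u + δ) * barrierResolvent G σ (u + δ)).trace.re ≤
      (barrierResolvent G σ (u + δ)).trace.re - (barrierResolvent G σ u).trace.re := by
  obtain ⟨h1, h2⟩ := neg_resolvent_posDef hu
  obtain ⟨h1', h2'⟩ := neg_resolvent_posDef hu'
  have e := resolvent_sub_eq u (u + δ) rfl rfl (barrier_mul_resolvent h1) (barrierResolvent_mul h1)
    (barrier_mul_resolvent h1') (barrierResolvent_mul h1')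
  set Z := barrierResolvent G σ u
  set W := barrierResolvent G σ (u + δ)
  have hP : (W * ((G⁻¹ - ν • (1 : Matrix n n ℂ)) + δ • (G⁻¹ * (-Z) * G⁻¹)) * W).PosSemidef := by
    apply PosSemidef.mul_mul_self _ (barrierResolvent_isHermitian hG σ (u + δ))
    exact hν.add ((h2.posSemidef.mul_mul_self hG.inv.isHermitian).smul hδ)
  have e2 : W - Z = δ • (W * ((G⁻¹ - ν • (1 : Matrix n n ℂ)) + δ • (G⁻¹ * (-Z) * G⁻¹)) * W) +
      (δ * ν) • (W * W) := by
    have h6 : (G⁻¹ - ν • (1 : Matrix n n ℂ)) + δ • (G⁻¹ * (-Z) * G⁻¹) =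
        (G⁻¹ + (u - (u + δ)) • (G⁻¹ * Z * G⁻¹)) - ν • (1 : Matrix n n ℂ) := by
      rw [mul_neg, neg_mul]; module
    rw [← neg_sub, e, h6, mul_sub, sub_mul, mul_smul_comm, smul_mul_assoc, mul_one]
    module
  have e3 := congrArg (fun M : Matrix n n ℂ => M.trace.re) e2
  have h0 := (hP.smul hδ).re_trace_nonneg
  simp only [Matrix.trace_sub, Matrix.trace_add, Complex.sub_re, Complex.add_re] at e3
  rw [Matrix.trace_smul (δ * ν), Complex.real_smul, Complex.re_ofReal_mul] at e3
  linarith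

end BarrierStep

/-! ### The barrier induction. -/

section BarrierIteration

open scoped ComplexOrder
open Matrix

variable {n : Type*}

theorem coordProj_posSemidef [DecidableEq n] (σ : Finset n) : (coordProj σ).PosSemidef := by
  apply Matrix.PosSemidef.diagonal
  intro i
  by_cases h : i ∈ σ <;> simp [h]

theorem re_trace_eq_sum [Fintype n] (A : Matrix n n ℂ) : A.trace.re = ∑ i, (A i i).re := by
  simp [Matrix.trace]

variable [Fintype n] [DecidableEq n] {G : Matrix n n ℂ}

/-- The coordinate compression of `G` to `σ` is at least `b` and at most `u`, and the two
barrier potentials at `b` and `u` are at most `-T` and `S`. -/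
structure BarrierState (G : Matrix n n ℂ) (σ : Finset n) (b u T S : ℝ) : Prop where
  isUnit : IsUnit (coordProj σ - b • G⁻¹)
  lower : (coordProj σ * G * coordProj σ - b • coordProj σ).PosSemidef
  lower_trace : T ≤ -(barrierResolvent G σ b).trace.re
  upper : (u • G⁻¹ - coordProj σ).PosDef
  upper_trace : -(barrierResolvent G σ u).trace.re ≤ S

/-- Shifting the barriers frees the amounts Δ₁ and Δ₂ of potential, and an index is admissible if
its rank-one update spends no more than that. Hypothesis `hT` makes the indices admissible below
outnumber those inadmissible above. -/
theorem BarrierState.exists_insert (hG : G.PosDef) {σ : Finset n} {ν b u T S δ η : ℝ}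
    (hν0 : 0 < ν) (hν : (G⁻¹ - ν • (1 : Matrix n n ℂ)).PosSemidef) (hdiag : ∀ i, G i i = 1)
    (hδ : 0 < δ) (hδb : δ < b) (hη : 0 < η)
    (hT : Fintype.card n + 1 / (δ * (1 - δ / b) * ν) + 1 / (b - δ) * (S + 1 / (η * ν)) < T)
    (hs : BarrierState G σ b u T S) :
    ∃ i, i ∉ σ ∧ BarrierState G (insert i σ) (b - δ) (u + η) T S := by
  have hb : 0 < b := hδ.trans hδb
  have hb' : 0 < b - δ := sub_pos.2 hδb
  have hlow' : (coordProj σ * G * coordProj σ - (b - δ) • coordProj σ).PosSemidef := by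
    have : coordProj σ * G * coordProj σ - (b - δ) • coordProj σ =
      (coordProj σ * G * coordProj σ - b • coordProj σ) + δ • coordProj σ := by module
    rw [this]
    exact hs.lower.add ((coordProj_posSemidef σ).smul hδ.le)
  have hu' := isUnit_coordProj_sub hG hb' (by linarith : b - δ < b) hs.lower
  have hup' : ((u + η) • G⁻¹ - coordProj σ).PosDef := by
    have : (u + η) • G⁻¹ - coordProj σ = (u • G⁻¹ - coordProj σ) + η • G⁻¹ := by module
    rw [this]
    exact hs.upper.add (hG.inv.smul hη)
  have hM := smul_resolvent_add_posSemidef hG hs.isUnit hs.lower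
  have hM' := smul_resolvent_add_posSemidef hG hu' hlow'
  obtain ⟨hv, hW⟩ := neg_resolvent_posDef hup'
  have hdl := re_trace_resolvent_lower_shift hG hν hb hδ.le hδb.le hs.isUnit hu' hM
  have hdu := re_trace_resolvent_upper_shift hG hν hη.le hs.upper hup'
  have hδb1 : 0 < 1 - δ / b := by rw [sub_pos, div_lt_one hb]; exact hδb
  have hκ : 0 < δ * (1 - δ / b) * ν := by positivity
  have hκ' : 0 < η * ν := by positivity
  set Z := barrierResolvent G σ (b - δ) with hZ
  set W := barrierResolvent G σ (u + η) with hWdef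
  set Δ₁ := (barrierResolvent G σ b).trace.re - Z.trace.re with hΔ₁
  set Δ₂ := W.trace.re - (barrierResolvent G σ u).trace.re with hΔ₂
  have hZ2 := resolvent_sq_posSemidef hG σ (b - δ)
  have hW2 := resolvent_sq_posSemidef hG σ (u + η)
  rw [← hZ] at hZ2
  rw [← hWdef] at hW2
  rw [re_trace_eq_sum] at hdl hdu
  have hΔ₁0 : 0 ≤ Δ₁ := le_trans
    (mul_nonneg hκ.le (Finset.sum_nonneg fun i _ => hZ2.re_diag_nonneg i)) hdl
  have hΔ₂0 : 0 ≤ Δ₂ := le_trans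
    (mul_nonneg hκ'.le (Finset.sum_nonneg fun i _ => hW2.re_diag_nonneg i)) hdu
  have hsumZ : ∑ i, -(Z i i).re = -Z.trace.re := by rw [re_trace_eq_sum, Finset.sum_neg_distrib]
  have hsumW : ∑ i, -(W i i).re = -W.trace.re := by rw [re_trace_eq_sum, Finset.sum_neg_distrib]
  have hcl := le_card_add_of_lower_barrier (fun i => -(Z i i).re) (fun i => ((Z * Z) i i).re)
    (κ := δ * (1 - δ / b) * ν) (Δ := Δ₁) (T := T) (M := 1 / (b - δ))
    (fun i => hZ2.re_diag_nonneg i) hκ hdl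
    (by rw [hsumZ]; linarith [hs.lower_trace]) (by
      intro i
      have h1 := hM'.re_diag_nonneg i
      simp only [Matrix.add_apply, Matrix.smul_apply, Complex.add_re, hdiag, Complex.one_re,
        Complex.real_smul, Complex.re_ofReal_mul] at h1
      rw [le_div_iff₀ hb']
      linarith)
  have hcu := card_le_of_upper_barrier (fun i => -(W i i).re) (fun i => ((W * W) i i).re)
    (κ := η * ν) (Δ := Δ₂)
    (fun i => by simpa using hW.posSemidef.re_diag_nonneg i)
    (fun i => hW2.re_diag_nonneg i) hκ' hdu
  rw [hsumW] at hcu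
  have hlt : (Finset.univ.filter fun i => ¬ (-(W i i).re < 1 ∧
      ((W * W) i i).re ≤ (1 - -(W i i).re) * Δ₂)).card <
      (Finset.univ.filter fun i => 1 < -(Z i i).re ∧
        ((Z * Z) i i).re ≤ (-(Z i i).re - 1) * Δ₁).card := by
    have h1 : -W.trace.re ≤ S := by linarith [hs.upper_trace]
    have h2 : 1 / (b - δ) * (S + 1 / (η * ν)) < 1 / (b - δ) *
      ((Finset.univ.filter fun i => 1 < -(Z i i).re ∧
        ((Z * Z) i i).re ≤ (-(Z i i).re - 1) * Δ₁).card : ℝ) := by linarith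
    have h3 := lt_of_mul_lt_mul_left h2 (by positivity)
    have h4 := lt_of_le_of_lt (hcu.trans (by linarith)) h3
    exact_mod_cast h4
  obtain ⟨i, hi1, hi2⟩ := Finset.exists_mem_notMem_of_card_lt_card hlt
  simp only [Finset.mem_filter, Finset.mem_univ, true_and, not_not] at hi1 hi2
  obtain ⟨hp, hq⟩ := hi1
  obtain ⟨hr, hq'⟩ := hi2
  have hiσ : i ∉ σ := by
    intro hi
    have := one_le_re_resolvent_diag hG hb'.le hu' hM' hi
    linarith
  have hne : 1 + (Z i i).re ≠ 0 := by linarith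
  have hne' : 1 + (W i i).re ≠ 0 := by linarith
  obtain ⟨hI1, hI2⟩ := barrierResolvent_insert_real hG hu' hiσ hne
  obtain ⟨hJ1, hJ2⟩ := barrierResolvent_insert_real hG hv hiσ hne'
  refine ⟨i, hiσ, hI1, ?_, ?_, ?_, ?_⟩
  · apply compression_posSemidef_of_resolvent hG hI1
    rw [hI2]
    -- Since 1 + Z i i < 0, the rank-one correction has a positive coefficient.
    have : (b - δ) • (Z - (1 + (Z i i).re)⁻¹ • (Z * Matrix.single i i 1 * Z)) + G =
        ((b - δ) • Z + G) +
        ((b - δ) * (-(1 + (Z i i).re))⁻¹) • (Z * Matrix.single i i 1 * Z) := by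
      rw [inv_neg]; module
    rw [this]
    refine hM'.add ((posSemidef_mul_single_mul
      (barrierResolvent_isHermitian hG σ (b - δ)) i).smul (mul_nonneg hb'.le ?_))
    exact inv_nonneg.2 (by linarith)
  · rw [re_trace_resolvent_insert hG hu' hiσ hne]
    have h1 : ((Z * Z) i i).re / (-(Z i i).re - 1) ≤ Δ₁ := by
      rw [div_le_iff₀ (by linarith)]; linarith
    have h2 : ((Z * Z) i i).re / (1 + (Z i i).re) = -(((Z * Z) i i).re / (-(Z i i).re - 1)) := by
      rw [← div_neg]; congr 1; ring
    rw [← hZ, h2]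
    linarith [hs.lower_trace]
  · have h1 : (-barrierResolvent G (insert i σ) (u + η)).PosDef := by
      have : -barrierResolvent G (insert i σ) (u + η) =
          -W + (1 + (W i i).re)⁻¹ • (W * Matrix.single i i 1 * W) := by
        rw [hJ2, ← hWdef]; abel
      rw [this]
      exact hW.add_posSemidef ((posSemidef_mul_single_mul
        (barrierResolvent_isHermitian hG σ (u + η)) i).smul (inv_nonneg.2 (by linarith)))
    have h2 : (-barrierResolvent G (insert i σ) (u + η))⁻¹ =
        (u + η) • G⁻¹ - coordProj (insert i σ) := by
      apply Matrix.inv_eq_right_inv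
      rw [neg_mul, ← mul_neg, neg_sub, barrierResolvent_mul hJ1]
    rw [← h2]
    exact h1.inv
  · rw [re_trace_resolvent_insert hG hv hiσ hne']
    have h1 : ((W * W) i i).re / (1 + (W i i).re) ≤ Δ₂ := by
      rw [div_le_iff₀ (by linarith)]; linarith
    linarith [hs.upper_trace]

theorem barrierState_empty (hG : G.PosDef) (hdiag : ∀ i, G i i = 1) {b u : ℝ} (hb : 0 < b)
    (hu : 0 < u) : BarrierState G ∅ b u (Fintype.card n / b) (Fintype.card n / u) := by
  have hD : coordProj (∅ : Finset n) = 0 := by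
    ext i j; simp [coordProj]
  have hR : ∀ t : ℝ, 0 < t → barrierResolvent G ∅ t = -(t⁻¹ • G) := by
    intro t ht
    apply Matrix.inv_eq_right_inv
    rw [hD, zero_sub, neg_mul_neg, smul_mul_smul_comm, hG.inv_mul_self, mul_inv_cancel₀ ht.ne',
      one_smul]
  have htr : ∀ t : ℝ, 0 < t → (barrierResolvent G ∅ t).trace.re = -(Fintype.card n / t) := by
    intro t ht
    have hG1 : G.trace = Fintype.card n := by simp [Matrix.trace, hdiag]
    rw [hR t ht, Matrix.trace_neg, Matrix.trace_smul, hG1, Complex.neg_re, Complex.real_smul,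
      Complex.re_ofReal_mul, Complex.natCast_re, div_eq_inv_mul]
  have hup : (u • G⁻¹ - coordProj (∅ : Finset n)).PosDef := by
    rw [hD, sub_zero]; exact hG.inv.smul hu
  refine ⟨?_, ?_, ?_, hup, ?_⟩
  · rw [hD, zero_sub]; exact (hG.inv.smul hb).isUnit.neg
  · rw [hD]; simpa using Matrix.PosSemidef.zero
  · rw [htr b hb, neg_neg]
  · rw [htr u hu, neg_neg]

/-- The barrier state bounds the quadratic form of the compression from both sides. -/
theorem BarrierState.quadForm_bounds (hG : G.PosDef) {σ : Finset n} {b u T S : ℝ} (hu : 0 < u)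
    (hs : BarrierState G σ b u T S) (x : n → ℂ) (hx : ∀ i, i ∉ σ → x i = 0) :
    b * (star x ⬝ᵥ x).re ≤ (star x ⬝ᵥ (G *ᵥ x)).re ∧
      (star x ⬝ᵥ (G *ᵥ x)).re ≤ u * (star x ⬝ᵥ x).re := by
  set D := coordProj σ with hD
  have hDx : D *ᵥ x = x := by
    ext i
    rw [hD, coordProj_mulVec_apply]
    split_ifs with h
    · rfl
    · exact (hx i h).symm
  have hDD : D * D = D := coordProj_mul_self σ
  have hxD : star x ᵥ* D = star x := by
    have := congrArg star hDx
    rwa [Matrix.star_mulVec, (coordProj_isHermitian σ).eq] at this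
  have hK : star x ⬝ᵥ ((D * G * D) *ᵥ x) = star x ⬝ᵥ (G *ᵥ x) := by
    rw [← Matrix.mulVec_mulVec, hDx, ← Matrix.mulVec_mulVec, Matrix.dotProduct_mulVec, hxD]
  constructor
  · have h := (Complex.le_def.1 (hs.lower.dotProduct_mulVec_nonneg x)).1
    rw [Matrix.sub_mulVec, Matrix.smul_mulVec, hDx, dotProduct_sub, dotProduct_smul, hK] at h
    simp only [Complex.zero_re, Complex.sub_re, Complex.real_smul, Complex.re_ofReal_mul] at h
    linarith
  · set K := D * G * D with hKdef
    have hDH := coordProj_isHermitian σ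
    have hKH : K.IsHermitian := by
      have := Matrix.isHermitian_conjTranspose_mul_mul D hG.isHermitian
      rwa [hDH.eq] at this
    have h1 : ((u • D - K)).PosSemidef := by
      -- Completing the square: the remainder is a congruence of u G⁻¹ - D, which is positive by the
      -- upper barrier.
      have e : u • D - K = u • ((D - u⁻¹ • K) * 1 * (D - u⁻¹ • K)) +
          u⁻¹ • (D * (G * (u • G⁻¹ - D) * G) * D) := by
        have h2 : G * (u • G⁻¹ - D) * G = u • G - G * D * G := by
          rw [mul_sub, sub_mul, mul_smul_comm, hG.mul_inv_self, smul_mul_assoc, one_mul]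
        have h3 : D * (G * D * G) * D = K * K := by
          rw [hKdef]
          simp only [mul_assoc]
          rw [← mul_assoc D D, hDD]
        have h4 : D * K = K := by rw [hKdef, ← mul_assoc, ← mul_assoc, hDD]
        have h5 : K * D = K := by rw [hKdef, mul_assoc, hDD]
        have h7 : D * (u • G - G * D * G) * D = u • K - K * K := by
          rw [mul_sub, sub_mul, h3, mul_smul_comm, smul_mul_assoc, ← hKdef]
        rw [h2, h7, mul_one]
        simp only [sub_mul, mul_sub, smul_mul_assoc, mul_smul_comm, hDD, h4, h5, smul_sub,
          smul_smul, inv_mul_cancel₀ hu.ne', mul_inv_cancel₀ hu.ne', one_smul]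
        have h6 : u * (u⁻¹ * u⁻¹) = u⁻¹ := by field_simp
        rw [h6]
        abel
      rw [e]
      refine PosSemidef.add (PosSemidef.smul ?_ hu.le) (PosSemidef.smul ?_ (inv_nonneg.2 hu.le))
      · exact Matrix.PosSemidef.one.mul_mul_self (hDH.sub (hKH.real_smul _))
      · exact (hs.upper.posSemidef.mul_mul_self hG.isHermitian).mul_mul_self hDH
    have h := (Complex.le_def.1 (h1.dotProduct_mulVec_nonneg x)).1
    rw [Matrix.sub_mulVec, Matrix.smul_mulVec, hDx, dotProduct_sub, dotProduct_smul, hK] at h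
    simp only [Complex.zero_re, Complex.sub_re, Complex.real_smul, Complex.re_ofReal_mul] at h
    linarith

theorem BarrierState.iterate (hG : G.PosDef) {ν b u T S δ η : ℝ}
    (hν0 : 0 < ν) (hν : (G⁻¹ - ν • (1 : Matrix n n ℂ)).PosSemidef) (hdiag : ∀ i, G i i = 1)
    (hδ : 0 < δ) (hη : 0 < η) (hs : BarrierState G ∅ b u T S) (m : ℕ)
    (hm : ∀ k : ℕ, k < m → δ < b - k * δ ∧
      Fintype.card n + 1 / (δ * (1 - δ / (b - k * δ)) * ν) +
        1 / (b - k * δ - δ) * (S + 1 / (η * ν)) < T) :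
    ∃ σ : Finset n, σ.card = m ∧ BarrierState G σ (b - m * δ) (u + m * η) T S := by
  induction m with
  | zero => exact ⟨∅, rfl, by simpa using hs⟩
  | succ m ih =>
    obtain ⟨σ, hc, hσ⟩ := ih fun k hk => hm k (hk.trans (Nat.lt_succ_self m))
    obtain ⟨h1, h2⟩ := hm m (Nat.lt_succ_self m)
    obtain ⟨i, hi, hi'⟩ := hσ.exists_insert hG hν0 hν hdiag hδ h1 hη h2
    refine ⟨insert i σ, by rw [Finset.card_insert_of_notMem hi, hc], ?_⟩
    have e1 : b - m * δ - δ = b - (m + 1 : ℕ) * δ := by push_cast; ring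
    have e2 : u + m * η + η = u + (m + 1 : ℕ) * η := by push_cast; ring
    rwa [e1, e2] at hi'

end BarrierIteration

/-! ### Choice of parameters and the selection theorem. -/

section TwoSidedSelection

open scoped ComplexOrder
open Matrix

/-- The right side, the initial lower potential, exceeds the shift cost 1/κ by at least 5N/4. This
pays for N and for the upper barrier term, which is at most N/8. -/
theorem barrier_parameters {ε ν N : ℝ} (hε : 0 < ε) (hε1 : ε < 1) (hν : 0 < ν) (hN : 0 < N)
    (hL : 128 / ε ^ 2 ≤ ν * N) {b : ℝ}
    (hb : ε ^ 2 / 16 ≤ b - ε / 2 / (ν * N)) :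
    ε / 2 / (ν * N) < b ∧
      N + 1 / (ε / 2 / (ν * N) * (1 - ε / 2 / (ν * N) / b) * ν) +
        1 / (b - ε / 2 / (ν * N)) *
          (N / (256 / ε ^ 2) + 1 / (256 / ε ^ 2 / (ν * N) * ν)) <
      N / (ε / 2 * (1 - 3 * ε / 4)) := by
  have hLpos : 0 < ν * N := mul_pos hν hN
  set δ := ε / 2 / (ν * N) with hδ
  have hδ0 : 0 < δ := by positivity
  have hf : 0 < ε ^ 2 / 16 := by positivity
  have hδb : δ < b := by linarith
  have hb0 : 0 < b := hδ0.trans hδb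
  refine ⟨hδb, ?_⟩
  have hδle : δ ≤ ε ^ 3 / 256 := by
    rw [hδ, div_le_iff₀ hLpos]
    rw [div_le_iff₀ (by positivity)] at hL
    have : ε ^ 3 / 256 * (ν * N) = ε / 256 * (ν * N * ε ^ 2) := by ring
    rw [this]
    nlinarith
  have hratio : δ / b ≤ ε / 16 := by
    rw [div_le_iff₀ hb0]
    nlinarith
  have h1 : 1 / (δ * (1 - δ / b) * ν) ≤ N / (ε / 2) * (1 + ε / 8) := by
    have e : N / (ε / 2) = 1 / (δ * ν) := by
      rw [hδ]; field_simp
    have h2 : (0:ℝ) < 1 - δ / b := by linarith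
    have e2 : 1 / (δ * (1 - δ / b) * ν) = 1 / (δ * ν) * (1 / (1 - δ / b)) := by
      field_simp
    rw [e, e2]
    apply mul_le_mul_of_nonneg_left _ (by positivity)
    rw [div_le_iff₀ h2]
    nlinarith
  have h3 : 1 / (b - δ) * (N / (256 / ε ^ 2) + 1 / (256 / ε ^ 2 / (ν * N) * ν)) ≤ N / 8 := by
    have e : N / (256 / ε ^ 2) + 1 / (256 / ε ^ 2 / (ν * N) * ν) = N * (ε ^ 2 / 128) := by
      field_simp; norm_num
    rw [e, one_div, inv_mul_le_iff₀ (by linarith)]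
    nlinarith
  have h4 : N / (ε / 2) * (1 + 3 * ε / 4) ≤ N / (ε / 2 * (1 - 3 * ε / 4)) := by
    have h5 : (0:ℝ) < 1 - 3 * ε / 4 := by linarith
    rw [← div_div]
    rw [le_div_iff₀ h5, mul_assoc]
    have : 0 ≤ N / (ε / 2) := by positivity
    nlinarith [sq_nonneg ε]
  have h6 : N / (ε / 2) * (1 + 3 * ε / 4) - N / (ε / 2) * (1 + ε / 8) = 5 / 4 * N := by
    field_simp; ring
  linarith

theorem exists_two_sided_selection_of_posDef {ε : ℝ} (hε : 0 < ε) (hε1 : ε < 1) {ν : ℝ}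
    (hν : 0 < ν) {n : Type*} [Fintype n] [DecidableEq n]
    (hn : 128 / ε ^ 2 ≤ ν * Fintype.card n) {G : Matrix n n ℂ} (hG : G.PosDef)
    (hdiag : ∀ i, G i i = 1) (hle : (1 - ν • G).PosSemidef) :
    ∃ σ : Finset n, (1 - ε) * (ν * Fintype.card n) ≤ σ.card ∧
      ∀ x : n → ℂ, (∀ i, i ∉ σ → x i = 0) →
        ε ^ 2 / 16 * (star x ⬝ᵥ x).re ≤ (star x ⬝ᵥ (G *ᵥ x)).re ∧
          (star x ⬝ᵥ (G *ᵥ x)).re ≤ 768 / ε ^ 2 * (star x ⬝ᵥ x).re := by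
  set N : ℝ := (Fintype.card n : ℝ) with hNdef
  have hL0 : 0 < ν * N := lt_of_lt_of_le (by positivity) hn
  have hN : 0 < N := pos_of_mul_pos_right hL0 hν.le
  set L := ν * N with hL
  set m := ⌈(1 - ε) * L⌉₊ with hm
  have hmle : (m : ℝ) ≤ (1 - ε) * L + 1 :=
    (Nat.ceil_lt_add_one (mul_nonneg (by linarith) hL0.le)).le
  have hL1 : 1 ≤ ε / 8 * L := by
    rw [div_le_iff₀ (by positivity)] at hn
    nlinarith
  have h34 : 0 < 1 - 3 * ε / 4 := by linarith
  -- The barrier loses at most (ε/2)(1 - ε + ε/8) in all, where ε/8 ≥ 1/L covers the rounding in m;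
  -- exactly ε²/16 is left.
  have hmb : ∀ k : ℝ, k ≤ m → ε ^ 2 / 16 ≤ ε / 2 * (1 - 3 * ε / 4) - k * (ε / 2 / L) := by
    intro k hk
    have h1 : k * (ε / 2 / L) ≤ ((1 - ε) * L + 1) * (ε / 2 / L) :=
      mul_le_mul_of_nonneg_right (hk.trans hmle) (by positivity)
    have h2 : ((1 - ε) * L + 1) * (ε / 2 / L) = ε / 2 * (1 - ε) + ε / 2 * (1 / L) := by
      field_simp
    have h3 : 1 / L ≤ ε / 8 := by rw [div_le_iff₀ hL0]; exact hL1
    nlinarith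
  have hs := barrierState_empty hG hdiag (b := ε / 2 * (1 - 3 * ε / 4)) (u := 256 / ε ^ 2)
    (by positivity) (by positivity)
  obtain ⟨σ, hσ, hst⟩ := hs.iterate hG hν (hG.inv_sub_smul_posSemidef hν.le hle) hdiag
    (δ := ε / 2 / L) (η := 256 / ε ^ 2 / L) (by positivity) (by positivity) m (by
      intro k hk
      apply barrier_parameters hε hε1 hν hN hn
      -- The barrier after the shift must still be at least ε²/16, hence k + 1.
      have := hmb (k + 1) (by exact_mod_cast hk)
      linarith)
  refine ⟨σ, ?_, ?_⟩
  · rw [hσ]; exact Nat.le_ceil _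
  · intro x hx
    obtain ⟨h1, h2⟩ := hst.quadForm_bounds hG (by positivity) x hx
    have hx0 : 0 ≤ (star x ⬝ᵥ x).re := (Complex.le_def.1 (dotProduct_star_self_nonneg x)).1
    refine ⟨(mul_le_mul_of_nonneg_right (hmb m le_rfl) hx0).trans h1,
      h2.trans (mul_le_mul_of_nonneg_right ?_ hx0)⟩
    have h3 : (m : ℝ) * (256 / ε ^ 2 / L) ≤ ((1 - ε) * L + 1) * (256 / ε ^ 2 / L) :=
      mul_le_mul_of_nonneg_right hmle (by positivity)
    have h4 : ((1 - ε) * L + 1) * (256 / ε ^ 2 / L) ≤ 2 * L * (256 / ε ^ 2 / L) := by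
      apply mul_le_mul_of_nonneg_right _ (by positivity)
      nlinarith
    have h5 : 2 * L * (256 / ε ^ 2 / L) = 512 / ε ^ 2 := by field_simp; norm_num
    have h6 : 768 / ε ^ 2 = 256 / ε ^ 2 + 512 / ε ^ 2 := by ring
    linarith

/-- A positive semidefinite matrix with unit diagonal and norm at most `1 / ν` has a principal
submatrix of size at least `(1 - ε) ν N` that is bounded from both sides in terms of `ε` only. -/
theorem exists_two_sided_selection {ε : ℝ} (hε : 0 < ε) (hε1 : ε < 1) {ν : ℝ}
    (hν : 0 < ν) (hν1 : ν ≤ 1) {n : Type*} [Fintype n] [DecidableEq n]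
    (hn : 128 / ε ^ 2 ≤ ν * Fintype.card n) {G : Matrix n n ℂ} (hG : G.PosSemidef)
    (hdiag : ∀ i, G i i = 1) (hle : (1 - ν • G).PosSemidef) :
    ∃ σ : Finset n, (1 - ε) * (ν * Fintype.card n) ≤ σ.card ∧
      ∀ x : n → ℂ, (∀ i, i ∉ σ → x i = 0) →
        ε ^ 2 / 32 * (star x ⬝ᵥ x).re ≤ (star x ⬝ᵥ (G *ᵥ x)).re ∧
          (star x ⬝ᵥ (G *ᵥ x)).re ≤ 1536 / ε ^ 2 * (star x ⬝ᵥ x).re := by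
  -- G may be singular, so τ is added and the diagonal rescaled to 1. As ε²/16 = 2τ, half of the
  -- lower bound survives when τ is removed.
  set τ := ε ^ 2 / 32 with hτ
  have hτ0 : 0 < τ := by positivity
  have hτ1 : τ ≤ 1 := by rw [hτ]; nlinarith
  have hG' : ((1 + τ)⁻¹ • (G + τ • (1 : Matrix n n ℂ))).PosDef :=
    (PosDef.posSemidef_add hG (PosDef.one.smul hτ0)).smul (by positivity)
  obtain ⟨σ, hσ, h⟩ := exists_two_sided_selection_of_posDef hε hε1 hν hn hG' (by
      intro i
      simp only [Matrix.smul_apply, Matrix.add_apply, hdiag, Matrix.one_apply_eq, Complex.real_smul]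
      push_cast
      have : (1 + (τ : ℂ)) ≠ 0 := by exact_mod_cast (by positivity : (1 + τ) ≠ 0)
      field_simp) (by
      have e : 1 - ν • ((1 + τ)⁻¹ • (G + τ • (1 : Matrix n n ℂ))) =
          (1 + τ)⁻¹ • ((1 - ν • G) + (τ * (1 - ν)) • (1 : Matrix n n ℂ)) := by
        have h1 : (1 : Matrix n n ℂ) - ν • ((1 + τ)⁻¹ • (G + τ • (1 : Matrix n n ℂ))) =
            ((1 + τ)⁻¹ * (1 + τ)) • (1 : Matrix n n ℂ) -
              ν • ((1 + τ)⁻¹ • (G + τ • (1 : Matrix n n ℂ))) := by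
          rw [inv_mul_cancel₀ (by positivity), one_smul]
        rw [h1]
        clear_value τ
        module
      rw [e]
      exact (hle.add (PosSemidef.one.smul (mul_nonneg hτ0.le (by linarith)))).smul (by positivity))
  refine ⟨σ, hσ, fun x hx => ?_⟩
  obtain ⟨h1, h2⟩ := h x hx
  have hx0 : 0 ≤ (star x ⬝ᵥ x).re := (Complex.le_def.1 (dotProduct_star_self_nonneg x)).1
  have e : (star x ⬝ᵥ (((1 + τ)⁻¹ • (G + τ • (1 : Matrix n n ℂ))) *ᵥ x)).re =
      (1 + τ)⁻¹ * ((star x ⬝ᵥ (G *ᵥ x)).re + τ * (star x ⬝ᵥ x).re) := by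
    rw [Matrix.smul_mulVec, Matrix.add_mulVec, Matrix.smul_mulVec, Matrix.one_mulVec,
      dotProduct_smul, dotProduct_add, dotProduct_smul]
    simp only [Complex.real_smul, Complex.re_ofReal_mul, Complex.add_re]
  rw [e] at h1 h2
  rw [le_inv_mul_iff₀ (by positivity)] at h1
  rw [inv_mul_le_iff₀ (by positivity)] at h2
  have h3 : ε ^ 2 / 16 = 2 * τ := by rw [hτ]; ring
  rw [h3] at h1
  have h4 : 1536 / ε ^ 2 = 2 * (768 / ε ^ 2) := by ring
  have h5 : 0 ≤ 768 / ε ^ 2 * (star x ⬝ᵥ x).re := by positivity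
  constructor
  · nlinarith [mul_nonneg (mul_nonneg hτ0.le hτ0.le) hx0]
  · rw [h4]; nlinarith [mul_nonneg hτ0.le hx0]

end TwoSidedSelection

/-! ### Counting in windows and a rising sun argument. -/

section Density

open Classical in
/-- The number of elements of `Λ` in the finite set `A`. -/
noncomputable def countIn (Λ : Set ℤ) (A : Finset ℤ) : ℕ := (A.filter (· ∈ Λ)).card

theorem countIn_le_card (Λ : Set ℤ) (A : Finset ℤ) : countIn Λ A ≤ A.card := by
  classical exact Finset.card_filter_le _ _

theorem countIn_congr {Λ Λ' : Set ℤ} {A : Finset ℤ} (h : ∀ z ∈ A, z ∈ Λ ↔ z ∈ Λ') :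
    countIn Λ A = countIn Λ' A := by
  classical
  unfold countIn
  congr 1
  exact Finset.filter_congr h

theorem countIn_Ico_add (Λ : Set ℤ) {a b c : ℤ} (hab : a ≤ b) (hbc : b ≤ c) :
    countIn Λ (Finset.Ico a c) = countIn Λ (Finset.Ico a b) + countIn Λ (Finset.Ico b c) := by
  classical
  unfold countIn
  rw [← Finset.Ico_union_Ico_eq_Ico hab hbc, Finset.filter_union, Finset.card_union_of_disjoint]
  exact Finset.disjoint_filter_filter (Finset.Ico_disjoint_Ico_consecutive a b c)

theorem countIn_of_bijective (Λ : Set ℤ) (e : ℤ ≃ ℤ) {A B : Finset ℤ} (h : ∀ z, z ∈ A ↔ e z ∈ B) :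
    countIn {z | e z ∈ Λ} A = countIn Λ B := by
  classical
  unfold countIn
  apply Finset.card_equiv e
  intro z
  simp [h z]

theorem countIn_shift (Λ : Set ℤ) (a b c : ℤ) :
    countIn {z | z + a ∈ Λ} (Finset.Ico b c) = countIn Λ (Finset.Ico (b + a) (c + a)) :=
  countIn_of_bijective Λ (Equiv.addRight a) (by intro z; simp)

/-- The positions `x` from which some window `[x, x + n)` with `n ≥ M` inside `(-∞, R)` has
density less than `c` in `Λ`. -/
def SparseFrom (Λ : Set ℤ) (c : ℝ) (M : ℕ) (R x : ℤ) : Prop :=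
  ∃ n : ℕ, M ≤ n ∧ x + n ≤ R ∧ (countIn Λ (Finset.Ico x (x + n)) : ℝ) < c * n

/-- A rising sun inequality: if no long interval is much denser than `d`, then the positions that
see a window of density below `d - ρ` to their right lower the count. -/
theorem countIn_add_sparse_le {Λ : Set ℤ} {d η ρ L : ℝ} {M : ℕ} (hη : 0 ≤ η) (hρ : 0 ≤ ρ)
    (hM1 : 1 ≤ M) (hM : 2 * L ≤ ρ * M)
    (H : ∀ (a : ℤ) (n : ℕ), (countIn Λ (Finset.Ico a (a + n)) : ℝ) ≤ (d + η) * n + L)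
    (R : ℤ) (k : ℕ) :
    (countIn Λ (Finset.Ico (R - k) R) : ℝ) +
      ρ / 2 * countIn {x | SparseFrom Λ (d - ρ) M R x} (Finset.Ico (R - k) R) ≤
        (d + η) * k + L := by
  classical
  induction k using Nat.strong_induction_on with
  | _ k ih =>
    set S := {x | SparseFrom Λ (d - ρ) M R x} with hS
    set B := (Finset.Ico (R - k) R).filter (· ∈ S) with hB
    rcases B.eq_empty_or_nonempty with hB0 | hB0
    · have h0 : countIn S (Finset.Ico (R - k) R) = 0 := by
        have : (countIn S (Finset.Ico (R - k) R)) = B.card := by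
          unfold countIn; rw [hB]
        rw [this, hB0, Finset.card_empty]
      rw [h0]
      have := H (R - k) k
      rw [sub_add_cancel] at this
      simpa using this
    -- Split at the leftmost sparse position x: no sparse position precedes it, its sparse window
    -- has length n, and induction handles the rest.
    · set x := B.min' hB0 with hx
      have hxB : x ∈ B := B.min'_mem hB0
      rw [hB, Finset.mem_filter, Finset.mem_Ico] at hxB
      obtain ⟨⟨hx1, hx2⟩, n, hn1, hn2, hn3⟩ := hxB
      have hbefore : countIn S (Finset.Ico (R - k) x) = 0 := by
        unfold countIn
        rw [Finset.card_eq_zero, Finset.filter_eq_empty_iff]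
        intro z hz hzS
        rw [Finset.mem_Ico] at hz
        have : x ≤ z := B.min'_le z (by
          rw [hB, Finset.mem_filter, Finset.mem_Ico]; exact ⟨⟨hz.1, by omega⟩, hzS⟩)
        omega
      obtain ⟨p, hp⟩ : ∃ p : ℕ, x = R - k + p := ⟨(x - (R - k)).toNat, by omega⟩
      obtain ⟨q, hq⟩ : ∃ q : ℕ, x + n = R - q := ⟨(R - (x + n)).toNat, by omega⟩
      have hsum : k = p + n + q := by omega
      have hq1 : q < k := by omega
      have h1 := ih q hq1
      have h2 := H (R - k) p
      rw [← hp] at h2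
      rw [← hq] at h1
      have e1 : ∀ T : Set ℤ, countIn T (Finset.Ico (R - k) R) = countIn T (Finset.Ico (R - k) x) +
          countIn T (Finset.Ico x (x + n)) + countIn T (Finset.Ico (x + n) R) := by
        intro T
        rw [countIn_Ico_add T hx1 hx2.le, countIn_Ico_add T (by omega : x ≤ x + n) hn2, add_assoc]
      rw [e1 Λ, e1 S, hbefore]
      have h3 : countIn S (Finset.Ico x (x + n)) ≤ n := by
        have := countIn_le_card S (Finset.Ico x (x + n))
        simpa using this
      have h3' : (countIn S (Finset.Ico x (x + n)) : ℝ) ≤ n := by exact_mod_cast h3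
      -- The window's deficit ρn has two uses: one half absorbs the extra L from the prefix, the
      -- other pays for at most n sparse positions.
      have h4 : ρ * M ≤ ρ * n := mul_le_mul_of_nonneg_left (by exact_mod_cast hn1) hρ
      have h5 : (k : ℝ) = p + n + q := by exact_mod_cast hsum
      push_cast
      rw [h5]
      have h6 : ρ / 2 * (countIn S (Finset.Ico x (x + n)) : ℝ) ≤ ρ / 2 * n :=
        mul_le_mul_of_nonneg_left h3' (by linarith)
      have h7 : 0 ≤ η * n := by positivity
      nlinarith

theorem countIn_sparse_le {Λ : Set ℤ} {d η ρ L : ℝ} {M N : ℕ} (hη : 0 ≤ η) (hρ : 0 ≤ ρ)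
    (hM1 : 1 ≤ M) (hM : 2 * L ≤ ρ * M)
    (H : ∀ (a : ℤ) (n : ℕ), (countIn Λ (Finset.Ico a (a + n)) : ℝ) ≤ (d + η) * n + L)
    (hd : d * N ≤ countIn Λ (Finset.Ico 0 N)) :
    ρ / 2 * countIn {x | SparseFrom Λ (d - ρ) M N x} (Finset.Ico 0 N) ≤ η * N + L := by
  have := countIn_add_sparse_le hη hρ hM1 hM H N N
  rw [sub_self] at this
  linarith

/-- The reflection of the interval `[0, N)`. -/
theorem countIn_reflect (Λ : Set ℤ) (N a b : ℤ) :
    countIn {z | N - 1 - z ∈ Λ} (Finset.Ico a b) = countIn Λ (Finset.Ico (N - b) (N - a)) :=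
  countIn_of_bijective Λ (Equiv.subLeft (N - 1)) (by intro z; simp; omega)

/-- Some position in the middle of `[0, N)` sees no sparse window on either side, on any of
finitely many scales. -/
theorem exists_centered_position {Λ : Set ℤ} {d : ℝ} {η ρ L : ℕ → ℝ} {M : ℕ → ℕ} {N K : ℕ}
    (hη : ∀ k, 0 ≤ η k) (hρ : ∀ k, 0 < ρ k) (hM1 : ∀ k, 1 ≤ M k) (hM : ∀ k, 2 * L k ≤ ρ k * M k)
    (H : ∀ k (a : ℤ) (n : ℕ), (countIn Λ (Finset.Ico a (a + n)) : ℝ) ≤ (d + η k) * n + L k)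
    (hd : d * N ≤ countIn Λ (Finset.Ico 0 N))
    (hN : ∑ k ∈ Finset.range K, 4 / ρ k * (η k * N + L k) + 2 * K < N) :
    ∃ x : ℤ, ∀ k < K, ∀ n : ℕ, M k ≤ n → n ≤ K →
      (d - ρ k) * n ≤ countIn Λ (Finset.Ico x (x + n)) ∧
      (d - ρ k) * n ≤ countIn Λ (Finset.Ico (x + 1 - n) (x + 1)) := by
  classical
  -- Reflection turns windows to the left into windows to the right.
  set Λ' : Set ℤ := {z | (N : ℤ) - 1 - z ∈ Λ} with hΛ'
  have H' : ∀ k (a : ℤ) (n : ℕ), (countIn Λ' (Finset.Ico a (a + n)) : ℝ) ≤ (d + η k) * n + L k := by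
    intro k a n
    rw [hΛ', countIn_reflect]
    have := H k ((N : ℤ) - (a + n)) n
    rwa [show (N : ℤ) - (a + n) + n = N - a by ring] at this
  have hd' : d * N ≤ countIn Λ' (Finset.Ico 0 N) := by
    rw [hΛ', countIn_reflect]; simpa using hd
  set S : ℕ → Set ℤ := fun k => {x | SparseFrom Λ (d - ρ k) (M k) N x} with hS
  set S' : ℕ → Set ℤ := fun k => {x | SparseFrom Λ' (d - ρ k) (M k) N x} with hS'
  set T : ℕ → Set ℤ := fun k => {x | (N : ℤ) - 1 - x ∈ S' k} with hT
  have hb : ∀ k, (countIn (S k) (Finset.Ico 0 N) : ℝ) + countIn (T k) (Finset.Ico 0 N) ≤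
      4 / ρ k * (η k * N + L k) := by
    intro k
    have h1 := countIn_sparse_le (hη k) (hρ k).le (hM1 k) (hM k) (H k) hd
    have h2 := countIn_sparse_le (hη k) (hρ k).le (hM1 k) (hM k) (H' k) hd'
    have h3 : countIn (T k) (Finset.Ico 0 N) = countIn (S' k) (Finset.Ico 0 N) := by
      rw [hT]; simp only; rw [countIn_reflect]; simp
    rw [h3, div_mul_eq_mul_div, le_div_iff₀ (hρ k)]
    change ρ k / 2 * countIn (S k) (Finset.Ico 0 N) ≤ _ at h1
    change ρ k / 2 * countIn (S' k) (Finset.Ico 0 N) ≤ _ at h2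
    linarith
  -- Excluded centres: those within K of an end, where windows could leave [0, N), and those with a
  -- sparse window on either side.
  set E := Finset.Ico (0 : ℤ) K ∪ Finset.Ico ((N : ℤ) - K) N ∪
    (Finset.range K).biUnion fun k => (Finset.Ico (0 : ℤ) N).filter (· ∈ S k) ∪
      (Finset.Ico (0 : ℤ) N).filter (· ∈ T k) with hE
  have hcard : E.card < (Finset.Ico (0 : ℤ) N).card := by
    have h1 : (E.card : ℝ) ≤ 2 * K + ∑ k ∈ Finset.range K,
        ((countIn (S k) (Finset.Ico 0 N) : ℝ) + countIn (T k) (Finset.Ico 0 N)) := by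
      have h2 : E.card ≤ K + K + ∑ k ∈ Finset.range K,
          (countIn (S k) (Finset.Ico 0 N) + countIn (T k) (Finset.Ico 0 N)) := by
        refine (Finset.card_union_le _ _).trans (add_le_add ?_ ?_)
        · refine (Finset.card_union_le _ _).trans ?_
          simp
        · refine Finset.card_biUnion_le.trans (Finset.sum_le_sum fun k _ => ?_)
          exact Finset.card_union_le _ _
      have h3 : (E.card : ℝ) ≤ ((K + K + ∑ k ∈ Finset.range K,
          (countIn (S k) (Finset.Ico 0 N) + countIn (T k) (Finset.Ico 0 N)) : ℕ) : ℝ) := by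
        exact_mod_cast h2
      push_cast at h3
      linarith
    have h4 := Finset.sum_le_sum fun k (_ : k ∈ Finset.range K) => hb k
    have h5 : (E.card : ℝ) < N := by linarith
    simpa using (by exact_mod_cast h5 : E.card < N)
  obtain ⟨x, hx, hxE⟩ := Finset.exists_mem_notMem_of_card_lt_card hcard
  simp only [hE, Finset.mem_union, Finset.mem_biUnion, Finset.mem_filter, Finset.mem_Ico,
    Finset.mem_range, not_or, not_exists, not_and] at hx hxE
  obtain ⟨⟨hx1, hx2⟩, hx3⟩ := hxE
  refine ⟨x, fun k hk n hMn hnK => ⟨?_, ?_⟩⟩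
  · by_contra hlt
    exact (hx3 k hk).1 hx ⟨n, hMn, by omega, not_le.1 hlt⟩
  · by_contra hlt
    refine (hx3 k hk).2 hx ⟨n, hMn, by omega, ?_⟩
    rw [hΛ', countIn_reflect]
    have e1 : (N : ℤ) - (N - 1 - x + n) = x + 1 - n := by ring
    have e2 : (N : ℤ) - (N - 1 - x) = x + 1 := by ring
    rw [e1, e2]
    exact not_le.1 hlt

end Density

/-! ### Maximal density and its attainment by one set. -/

section MaximalDensity

/-- The largest number of elements that a set in the family `𝒜` has in `[0, n)`. -/
noncomputable def maxCount (𝒜 : Set ℤ → Prop) (n : ℕ) : ℕ :=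
  sSup {m | ∃ Λ, 𝒜 Λ ∧ countIn Λ (Finset.Ico 0 n) = m}

variable {𝒜 : Set ℤ → Prop}

theorem bddAbove_counts (𝒜 : Set ℤ → Prop) (n : ℕ) :
    BddAbove {m | ∃ Λ, 𝒜 Λ ∧ countIn Λ (Finset.Ico 0 n) = m} := by
  refine ⟨n, ?_⟩
  rintro m ⟨Λ, -, rfl⟩
  simpa using countIn_le_card Λ (Finset.Ico 0 n)

theorem countIn_le_maxCount (hshift : ∀ Λ (a : ℤ), 𝒜 Λ → 𝒜 {z | z + a ∈ Λ}) {Λ : Set ℤ}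
    (hΛ : 𝒜 Λ) (a : ℤ) (n : ℕ) : countIn Λ (Finset.Ico a (a + n)) ≤ maxCount 𝒜 n := by
  apply le_csSup (bddAbove_counts 𝒜 n)
  refine ⟨_, hshift Λ a hΛ, ?_⟩
  rw [countIn_shift, zero_add, add_comm a]

theorem exists_countIn_eq_maxCount (hne : ∃ Λ, 𝒜 Λ) (n : ℕ) :
    ∃ Λ, 𝒜 Λ ∧ countIn Λ (Finset.Ico 0 n) = maxCount 𝒜 n := by
  obtain ⟨Λ, hΛ⟩ := hne
  have hS : {m | ∃ Λ, 𝒜 Λ ∧ countIn Λ (Finset.Ico 0 n) = m}.Nonempty := ⟨_, Λ, hΛ, rfl⟩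
  exact Nat.sSup_mem hS (bddAbove_counts 𝒜 n)

theorem maxCount_le (hne : ∃ Λ, 𝒜 Λ) (n : ℕ) : maxCount 𝒜 n ≤ n := by
  obtain ⟨Λ, -, h⟩ := exists_countIn_eq_maxCount hne n
  rw [← h]
  simpa using countIn_le_card Λ (Finset.Ico 0 n)

theorem maxCount_subadditive (hne : ∃ Λ, 𝒜 Λ)
    (hshift : ∀ Λ (a : ℤ), 𝒜 Λ → 𝒜 {z | z + a ∈ Λ}) :
    Subadditive fun n => (maxCount 𝒜 n : ℝ) := by
  intro m n
  obtain ⟨Λ, hΛ, h⟩ := exists_countIn_eq_maxCount hne (m + n)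
  have h1 := countIn_le_maxCount hshift hΛ 0 m
  have h2 := countIn_le_maxCount hshift hΛ m n
  rw [zero_add] at h1
  have h3 : maxCount 𝒜 (m + n) ≤ maxCount 𝒜 m + maxCount 𝒜 n := by
    rw [← h, countIn_Ico_add Λ (b := m) (by omega) (by push_cast; omega)]
    push_cast at h2 ⊢
    exact add_le_add h1 h2
  beta_reduce
  exact_mod_cast h3

theorem bddBelow_maxCount_div (𝒜 : Set ℤ → Prop) :
    BddBelow (Set.range fun n : ℕ => (maxCount 𝒜 n : ℝ) / n) := by
  refine ⟨0, ?_⟩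
  rintro _ ⟨n, rfl⟩
  positivity

theorem exists_linear_bound_of_tendsto (hne : ∃ Λ, 𝒜 Λ) {d : ℝ} (hd0 : 0 ≤ d)
    (hd : Tendsto (fun n : ℕ => (maxCount 𝒜 n : ℝ) / n) atTop (𝓝 d)) {η : ℝ} (hη : 0 < η) :
    ∃ L : ℝ, 0 ≤ L ∧ ∀ n : ℕ, (maxCount 𝒜 n : ℝ) ≤ (d + η) * n + L := by
  have h := (hd.eventually (gt_mem_nhds (by linarith : d < d + η)))
  obtain ⟨N, hN⟩ := eventually_atTop.1 h
  refine ⟨N, by positivity, fun n => ?_⟩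
  have h0 : (0 : ℝ) ≤ (d + η) * n := by positivity
  by_cases hn : N ≤ n
  · rcases Nat.eq_zero_or_pos n with rfl | hpos
    · have : (maxCount 𝒜 0 : ℝ) ≤ (0 : ℕ) := by exact_mod_cast maxCount_le hne 0
      have h1 : (0 : ℝ) ≤ N := by positivity
      push_cast at this ⊢
      linarith
    · have h1 := hN n hn
      rw [div_lt_iff₀ (by exact_mod_cast hpos)] at h1
      have h2 : (0 : ℝ) ≤ N := by positivity
      linarith
  · have h1 : (maxCount 𝒜 n : ℝ) ≤ n := by exact_mod_cast maxCount_le hne n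
    have h2 : (n : ℝ) ≤ N := by exact_mod_cast (not_le.1 hn).le
    linarith

/-- Sets in `𝒜` whose two one-sided counts at the origin nearly reach the maximal density on
finitely many scales. -/
theorem exists_centered_set (hne : ∃ Λ, 𝒜 Λ)
    (hshift : ∀ Λ (a : ℤ), 𝒜 Λ → 𝒜 {z | z + a ∈ Λ}) {d : ℝ} (hd0 : 0 ≤ d)
    (hd : Tendsto (fun n : ℕ => (maxCount 𝒜 n : ℝ) / n) atTop (𝓝 d))
    (hle : ∀ n : ℕ, d * n ≤ maxCount 𝒜 n) :
    ∃ M : ℕ → ℕ, ∀ K : ℕ, ∃ Λ, 𝒜 Λ ∧ ∀ k < K, ∀ n : ℕ, M k ≤ n → n ≤ K →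
      (d - 1 / (k + 1)) * n ≤ countIn Λ (Finset.Ico 0 n) ∧
      (d - 1 / (k + 1)) * n ≤ countIn Λ (Finset.Ico (1 - n) 1) := by
  set ρ : ℕ → ℝ := fun k => 1 / (k + 1) with hρ
  have hρ0 : ∀ k, 0 < ρ k := fun k => by rw [hρ]; positivity
  -- The geometric factor makes the proportional part of the excluded centres at most N/2 over all
  -- scales; N is then taken large enough for the constant part.
  set η : ℕ → ℝ := fun k => ρ k * ((1 / 2) ^ k / 16) with hη
  have hη0 : ∀ k, 0 < η k := fun k => by have := hρ0 k; rw [hη]; positivity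
  choose L hL0 hL using fun k => exists_linear_bound_of_tendsto hne hd0 hd (hη0 k)
  -- The threshold does not depend on K, so it survives the limit K → ∞.
  refine ⟨fun k => ⌈2 * L k * (k + 1)⌉₊ + 1, fun K => ?_⟩
  obtain ⟨N, hN⟩ := exists_nat_gt (2 * (∑ k ∈ Finset.range K, 4 / ρ k * L k + 2 * K))
  obtain ⟨Λ, hΛ, hc⟩ := exists_countIn_eq_maxCount hne N
  obtain ⟨x, hx⟩ := exists_centered_position (Λ := Λ) (d := d) (η := η) (ρ := ρ) (L := L)
    (M := fun k => ⌈2 * L k * (k + 1)⌉₊ + 1) (N := N) (K := K) (fun k => (hη0 k).le) hρ0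
    (fun k => Nat.le_add_left 1 _) (fun k => by
      have h1 : 2 * L k * (k + 1) ≤ ((⌈2 * L k * (k + 1)⌉₊ + 1 : ℕ) : ℝ) := by
        push_cast; linarith [Nat.le_ceil (2 * L k * (k + 1))]
      have h2 : ρ k * (2 * L k * (k + 1)) = 2 * L k := by rw [hρ]; field_simp
      refine h2.ge.trans ?_
      exact mul_le_mul_of_nonneg_left h1 (hρ0 k).le)
    (fun k a n => by
      have : (countIn Λ (Finset.Ico a (a + n)) : ℝ) ≤ maxCount 𝒜 n := by
        exact_mod_cast countIn_le_maxCount hshift hΛ a n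
      exact this.trans (hL k n))
    (by rw [hc]; exact hle N)
    (by
      have h1 : ∀ k, 4 / ρ k * (η k * N + L k) = (1 / 2 : ℝ) ^ k * (N / 4) + 4 / ρ k * L k := by
        intro k
        have := (hρ0 k).ne'
        rw [hη]; field_simp; ring
      simp_rw [h1]
      rw [Finset.sum_add_distrib, ← Finset.sum_mul]
      have h2 : ∑ k ∈ Finset.range K, (1 / 2 : ℝ) ^ k ≤ 2 := sum_geometric_two_le K
      have h3 : (∑ k ∈ Finset.range K, (1 / 2 : ℝ) ^ k) * (N / 4) ≤ 2 * ((N : ℝ) / 4) :=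
        mul_le_mul_of_nonneg_right h2 (by positivity)
      linarith)
  refine ⟨{z | z + x ∈ Λ}, hshift Λ x hΛ, fun k hk n hn hnK => ?_⟩
  obtain ⟨h1, h2⟩ := hx k hk n hn hnK
  rw [countIn_shift, countIn_shift]
  have e1 : (0 : ℤ) + x = x := zero_add x
  have e2 : (n : ℤ) + x = x + n := add_comm _ _
  have e3 : 1 - (n : ℤ) + x = x + 1 - n := by ring
  have e4 : 1 + x = x + 1 := add_comm _ _
  rw [e1, e2, e3, e4]
  exact ⟨h1, h2⟩

/-- A compact, hereditary, translation invariant family of sets of integers contains a set whose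
two-sided density exists and is the maximal one. -/
theorem exists_hasTwoSidedDensity (hmono : ∀ Λ Λ', 𝒜 Λ → Λ' ⊆ Λ → 𝒜 Λ')
    (hshift : ∀ Λ (a : ℤ), 𝒜 Λ → 𝒜 {z | z + a ∈ Λ})
    (hfin : ∀ Λ : Set ℤ, (∀ s : Finset ℤ, ↑s ⊆ Λ → 𝒜 s) → 𝒜 Λ) {θ : ℝ}
    (hlarge : ∀ᶠ N : ℕ in atTop, ∃ Λ, 𝒜 Λ ∧ θ * N ≤ countIn Λ (Finset.Ico 0 N)) :
    ∃ (Λ : Set ℤ) (d : ℝ), 𝒜 Λ ∧ HasTwoSidedDensity Λ d ∧ θ ≤ d := by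
  classical
  have hne : ∃ Λ, 𝒜 Λ := by
    obtain ⟨N, Λ, h, -⟩ := hlarge.exists
    exact ⟨Λ, h⟩
  have hsub := maxCount_subadditive hne hshift
  set d := hsub.lim with hddef
  have hd : Tendsto (fun n : ℕ => (maxCount 𝒜 n : ℝ) / n) atTop (𝓝 d) :=
    hsub.tendsto_lim (bddBelow_maxCount_div 𝒜)
  have hd0 : 0 ≤ d := ge_of_tendsto' hd fun n => by positivity
  have hle : ∀ n : ℕ, d * n ≤ maxCount 𝒜 n := by
    intro n
    rcases Nat.eq_zero_or_pos n with rfl | hn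
    · simp
    · have := hsub.lim_le_div (bddBelow_maxCount_div 𝒜) hn.ne'
      rwa [le_div_iff₀ (by exact_mod_cast hn)] at this
  have hθ : θ ≤ d := by
    apply ge_of_tendsto hd
    filter_upwards [hlarge, eventually_gt_atTop 0] with N hN hpos
    obtain ⟨Λ, hΛ, h⟩ := hN
    rw [le_div_iff₀ (by exact_mod_cast hpos)]
    have h1 := countIn_le_maxCount hshift hΛ 0 N
    rw [zero_add] at h1
    exact h.trans (by exact_mod_cast h1)
  obtain ⟨M, hM⟩ := exists_centered_set hne hshift hd0 hd hle
  choose Λs hΛs hcount using hM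
  -- The ultrafilter limit agrees on every finite set with some, arbitrarily late, `Λs K`.
  set Λ : Set ℤ := {z | ∀ᶠ K in (hyperfilter ℕ : Filter ℕ), z ∈ Λs K} with hΛ
  have hagree : ∀ A : Finset ℤ, ∀ᶠ K in (hyperfilter ℕ : Filter ℕ), ∀ z ∈ A,
      (z ∈ Λ ↔ z ∈ Λs K) := by
    intro A
    rw [Filter.eventually_all_finset]
    intro z _
    by_cases hz : ∀ᶠ K in (hyperfilter ℕ : Filter ℕ), z ∈ Λs K
    · filter_upwards [hz] with K hK
      exact ⟨fun _ => hK, fun _ => hz⟩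
    · have hz' := Ultrafilter.eventually_not.2 hz
      filter_upwards [hz'] with K hK
      exact ⟨fun h => absurd h hz, fun h => absurd h hK⟩
  have hgood : 𝒜 Λ := by
    apply hfin
    intro s hs
    obtain ⟨K, hK⟩ := (hagree s).exists
    exact hmono _ _ (hΛs K) fun z hz => (hK z hz).1 (hs hz)
  have hlow : ∀ k n : ℕ, M k ≤ n →
      (d - 1 / (k + 1)) * n ≤ countIn Λ (Finset.Ico 0 n) ∧
      (d - 1 / (k + 1)) * n ≤ countIn Λ (Finset.Ico (1 - n) 1) := by
    intro k n hkn
    have hev : ∀ᶠ K in (hyperfilter ℕ : Filter ℕ), k < K ∧ n ≤ K :=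
      (Nat.hyperfilter_le_atTop) ((eventually_gt_atTop k).and (eventually_ge_atTop n))
    obtain ⟨K, ⟨hK1, hK2⟩, h1, h2⟩ := (hev.and ((hagree (Finset.Ico 0 n)).and
      (hagree (Finset.Ico (1 - n) 1)))).exists
    rw [countIn_congr h1, countIn_congr h2]
    exact hcount K k hK1 n hkn hK2
  refine ⟨Λ, d, hgood, ?_, hθ⟩
  have hncard : ∀ n : ℕ, (Λ ∩ Set.Icc (-(n : ℤ)) n).ncard =
      countIn Λ (Finset.Ico (-(n : ℤ)) (-(n : ℤ) + (2 * n + 1 : ℕ))) := by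
    intro n
    unfold countIn
    rw [← Set.ncard_coe_finset]
    congr 1
    ext z
    simp only [Set.mem_inter_iff, Set.mem_Icc, Finset.coe_filter, Finset.mem_Ico, Set.mem_ofPred_eq]
    constructor
    · rintro ⟨h1, h2, h3⟩; exact ⟨⟨h2, by push_cast; omega⟩, h1⟩
    · rintro ⟨⟨h1, h2⟩, h3⟩; exact ⟨h3, h1, by push_cast at h2; omega⟩
  have hhalf : Tendsto (fun n : ℕ => 1 / (2 * (n : ℝ))) atTop (𝓝 0) := by
    have := (tendsto_one_div_atTop_nhds_zero_nat (𝕜 := ℝ)).const_mul (1 / 2 : ℝ)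
    rw [mul_zero] at this
    refine this.congr fun n => ?_
    rw [one_div_mul_one_div]
  unfold HasTwoSidedDensity
  simp_rw [hncard]
  rw [tendsto_order]
  constructor
  · intro c hc
    obtain ⟨k, hk⟩ := exists_nat_one_div_lt (show 0 < (d - c) / 2 by linarith)
    filter_upwards [eventually_ge_atTop (M k), eventually_gt_atTop 0,
      hhalf.eventually (gt_mem_nhds (show 0 < (d - c) / 2 by linarith))] with n hn hn0 hn1
    obtain ⟨h1, h2⟩ := hlow k n hn
    have hn0' : (0 : ℝ) < n := by exact_mod_cast hn0
    rw [lt_div_iff₀ (by positivity)]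
    have e1 := countIn_Ico_add Λ (a := -(n : ℤ)) (b := 0) (c := -(n : ℤ) + (2 * n + 1 : ℕ))
      (by omega) (by push_cast; omega)
    have e2 := countIn_Ico_add Λ (a := 0) (b := (n : ℤ)) (c := -(n : ℤ) + (2 * n + 1 : ℕ))
      (by omega) (by push_cast; omega)
    have e3 := countIn_Ico_add Λ (a := 1 - (n : ℤ)) (b := 0) (c := 1)
      (by omega) (by omega)
    have e4 := countIn_Ico_add Λ (a := -(n : ℤ)) (b := 1 - n) (c := 0)
      (by omega) (by omega)
    have e5 : countIn Λ (Finset.Ico 0 1) ≤ 1 := by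
      simpa using countIn_le_card Λ (Finset.Ico 0 1)
    -- The two half-windows overlap only at 0, which costs at most 1.
    have e6 : countIn Λ (Finset.Ico 0 n) + countIn Λ (Finset.Ico (1 - n) 1) ≤
        countIn Λ (Finset.Ico (-(n : ℤ)) (-(n : ℤ) + (2 * n + 1 : ℕ))) + 1 := by omega
    have e7 : (countIn Λ (Finset.Ico 0 n) : ℝ) + countIn Λ (Finset.Ico (1 - n) 1) ≤
        countIn Λ (Finset.Ico (-(n : ℤ)) (-(n : ℤ) + (2 * n + 1 : ℕ))) + 1 := by exact_mod_cast e6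
    rw [div_lt_iff₀ (by positivity)] at hn1
    nlinarith
  · intro c hc
    have h1 : Tendsto (fun n : ℕ => (maxCount 𝒜 (2 * n + 1) : ℝ) / (2 * n + 1 : ℕ) *
        (1 + 1 / (2 * (n : ℝ)))) atTop (𝓝 (d * (1 + 0))) := by
      refine Tendsto.mul (hd.comp ?_) (hhalf.const_add 1)
      exact tendsto_atTop_mono (fun n => by omega : ∀ n : ℕ, n ≤ 2 * n + 1) tendsto_id
    rw [add_zero, mul_one] at h1
    filter_upwards [h1.eventually (gt_mem_nhds hc), eventually_gt_atTop 0] with n hn hn0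
    refine lt_of_le_of_lt ?_ hn
    have hn0' : (0 : ℝ) < n := by exact_mod_cast hn0
    have e1 : (maxCount 𝒜 (2 * n + 1) : ℝ) / (2 * n + 1 : ℕ) * (1 + 1 / (2 * (n : ℝ))) =
        maxCount 𝒜 (2 * n + 1) / (2 * n) := by
      push_cast; field_simp
    rw [e1]
    apply div_le_div_of_nonneg_right _ (by positivity)
    exact_mod_cast countIn_le_maxCount hshift hgood (-(n : ℤ)) (2 * n + 1)

end MaximalDensity

/-! ### Norm comparison for trigonometric polynomials and its extension to L₂. -/

section ExponentialSystems

open scoped ComplexOrder InnerProductSpace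

/-- Restriction to `B` as a map between `L²` spaces. -/
noncomputable def restrictL2 (B : Set UnitAddCircle) :
    Lp ℂ 2 circleMeasure →L[ℂ] Lp ℂ 2 (circleMeasure.restrict B) :=
  LpToLpRestrictCLM UnitAddCircle ℂ ℂ circleMeasure 2 B

theorem norm_sq_Lp_eq_integral {α : Type*} {m : MeasurableSpace α} {μ : Measure α}
    (f : Lp ℂ 2 μ) : ‖f‖ ^ 2 = ∫ t, ‖f t‖ ^ 2 ∂μ := by
  have h := congrArg RCLike.re (@L2.inner_def α ℂ ℂ _ _ μ _ _ f f)
  rw [← integral_re (L2.integrable_inner f f)] at h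
  simpa only [← norm_sq_eq_re_inner] using h

theorem norm_sq_restrictL2 (B : Set UnitAddCircle) (f : Lp ℂ 2 circleMeasure) :
    ‖restrictL2 B f‖ ^ 2 = ∫ t in B, ‖f t‖ ^ 2 ∂circleMeasure := by
  rw [norm_sq_Lp_eq_integral]
  apply integral_congr_ae
  filter_upwards [LpToLpRestrictCLM_coeFn (F := ℂ) ℂ B f] with t ht
  rw [restrictL2, ht]

theorem norm_sq_restrictL2_le (B : Set UnitAddCircle) (f : Lp ℂ 2 circleMeasure) :
    ‖restrictL2 B f‖ ^ 2 ≤ ‖f‖ ^ 2 := by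
  rw [norm_sq_restrictL2, norm_sq_Lp_eq_integral]
  apply setIntegral_le_integral
  · exact (memLp_two_iff_integrable_sq_norm (Lp.aestronglyMeasurable f)).1 (Lp.memLp f)
  · exact Eventually.of_forall fun t => by positivity

/-- The trigonometric polynomial with coefficients `c` and frequencies in `s`. -/
noncomputable def trigPoly (s : Finset ℤ) (c : ℤ → ℂ) : Lp ℂ 2 circleMeasure :=
  ∑ k ∈ s, c k • fourierLp 2 k

theorem trigPoly_coeFn (s : Finset ℤ) (c : ℤ → ℂ) :
    trigPoly s c =ᵐ[circleMeasure] fun t => ∑ k ∈ s, c k * fourier k t := by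
  have h1 := Lp.coeFn_finsetSum s fun k => c k • fourierLp (T := (1 : ℝ)) 2 k
  have h2 : ∀ᵐ t ∂circleMeasure, ∀ k : ℤ,
      (c k • fourierLp (T := (1 : ℝ)) 2 k : Lp ℂ 2 circleMeasure) t = c k * fourier k t := by
    rw [ae_all_iff]
    intro k
    filter_upwards [Lp.coeFn_smul (c k) (fourierLp (T := (1 : ℝ)) 2 k),
      coeFn_fourierLp (T := (1 : ℝ)) 2 k] with t h3 h4
    rw [h3, Pi.smul_apply, h4, smul_eq_mul]
  filter_upwards [h1, h2] with t h3 h4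
  rw [trigPoly, h3, Finset.sum_apply]
  exact Finset.sum_congr rfl fun k _ => h4 k

theorem norm_sq_restrictL2_trigPoly (B : Set UnitAddCircle) (s : Finset ℤ) (c : ℤ → ℂ) :
    ‖restrictL2 B (trigPoly s c)‖ ^ 2 =
      ∫ t in B, ‖∑ k ∈ s, c k * (fourier k t : ℂ)‖ ^ 2 ∂circleMeasure := by
  rw [norm_sq_restrictL2]
  apply integral_congr_ae
  filter_upwards [ae_restrict_of_ae (trigPoly_coeFn s c)] with t ht
  rw [ht]

theorem norm_sq_trigPoly (s : Finset ℤ) (c : ℤ → ℂ) :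
    ‖trigPoly s c‖ ^ 2 = ∑ k ∈ s, ‖c k‖ ^ 2 := by
  have h := (orthonormal_fourier (T := (1 : ℝ))).inner_sum c c s
  rw [norm_sq_eq_re_inner (𝕜 := ℂ), trigPoly, h]
  simp only [Complex.conj_mul', map_sum]
  refine Finset.sum_congr rfl fun k _ => ?_
  norm_cast

/-- On trigonometric polynomials with frequencies in `Λ`, the normalized square norm on `B` is
comparable with the square norm on the circle. -/
def ComparableOn (B : Set UnitAddCircle) (a b : ℝ) (Λ : Set ℤ) : Prop :=
  ∀ (s : Finset ℤ) (c : ℤ → ℂ), ↑s ⊆ Λ →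
    a * ‖trigPoly s c‖ ^ 2 ≤ 1 / circleMeasure.real B * ‖restrictL2 B (trigPoly s c)‖ ^ 2 ∧
    1 / circleMeasure.real B * ‖restrictL2 B (trigPoly s c)‖ ^ 2 ≤ b * ‖trigPoly s c‖ ^ 2

variable {B : Set UnitAddCircle} {a b : ℝ}

theorem ComparableOn.mono {Λ Λ' : Set ℤ} (h : ComparableOn B a b Λ) (h' : Λ' ⊆ Λ) :
    ComparableOn B a b Λ' := fun s c hs => h s c (hs.trans h')

theorem comparableOn_of_finset {Λ : Set ℤ} (h : ∀ s : Finset ℤ, ↑s ⊆ Λ → ComparableOn B a b s) :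
    ComparableOn B a b Λ := fun s c hs => h s hs s c subset_rfl

/-- Translating frequencies multiplies the polynomial by a unimodular character, which changes
neither norm. -/
theorem ComparableOn.shift {Λ : Set ℤ} (h : ComparableOn B a b Λ) (j : ℤ) :
    ComparableOn B a b {z | z + j ∈ Λ} := by
  intro s c hs
  set s' := s.map (Equiv.addRight j).toEmbedding with hs'
  set c' : ℤ → ℂ := fun k => c (k - j) with hc'
  have h1 := h s' c' (by
    intro z hz
    simp only [hs', Finset.coe_map, Set.mem_image, Finset.mem_coe] at hz
    obtain ⟨w, hw, rfl⟩ := hz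
    exact hs hw)
  have e1 : ‖trigPoly s' c'‖ ^ 2 = ‖trigPoly s c‖ ^ 2 := by
    rw [norm_sq_trigPoly, norm_sq_trigPoly, hs', Finset.sum_map]
    simp [hc']
  have e2 : ‖restrictL2 B (trigPoly s' c')‖ ^ 2 = ‖restrictL2 B (trigPoly s c)‖ ^ 2 := by
    rw [norm_sq_restrictL2_trigPoly, norm_sq_restrictL2_trigPoly]
    congr 1
    ext t
    have e3 : ∑ k ∈ s', c' k * (fourier k t : ℂ) =
        (∑ k ∈ s, c k * (fourier k t : ℂ)) * fourier j t := by
      rw [hs', Finset.sum_map, Finset.sum_mul]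
      refine Finset.sum_congr rfl fun k _ => ?_
      simp only [hc', Equiv.coe_toEmbedding, Equiv.coe_addRight, add_sub_cancel_right, fourier_add]
      ring
    have e4 : ‖(fourier j t : ℂ)‖ = 1 := by rw [fourier_apply]; exact Circle.norm_coe _
    rw [e3, norm_mul, e4, mul_one]
  rwa [e1, e2] at h1

/-- A function with spectrum in a comparable set satisfies the norm comparison. -/
theorem ComparableOn.norm_sq_bounds {Λ : Set ℤ} (h : ComparableOn B a b Λ)
    (F : Lp ℂ 2 circleMeasure) (hF : ∀ k ∉ Λ, fourierCoeff F k = 0) :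
    a * ‖F‖ ^ 2 ≤ 1 / circleMeasure.real B * ‖restrictL2 B F‖ ^ 2 ∧
    1 / circleMeasure.real B * ‖restrictL2 B F‖ ^ 2 ≤ b * ‖F‖ ^ 2 := by
  classical
  have hs : Tendsto (fun s : Finset ℤ => trigPoly s (fourierCoeff F)) atTop (𝓝 F) :=
    hasSum_fourier_series_L2 F
  have hb : ∀ s : Finset ℤ,
      trigPoly s (fourierCoeff F) = trigPoly (s.filter (· ∈ Λ)) (fourierCoeff F) := by
    intro s
    unfold trigPoly
    rw [Finset.sum_filter]
    refine Finset.sum_congr rfl fun k _ => ?_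
    split_ifs with hk
    · rfl
    · rw [hF k hk, zero_smul]
  have hsub : ∀ s : Finset ℤ, (↑(s.filter (· ∈ Λ)) : Set ℤ) ⊆ Λ := by
    intro s z hz
    simp only [Finset.coe_filter] at hz
    exact hz.2
  have hn := (hs.norm).pow 2
  have hr := (((restrictL2 B).continuous.tendsto F).comp hs).norm.pow 2
  constructor
  · refine le_of_tendsto_of_tendsto' (hn.const_mul a) (hr.const_mul _) fun s => ?_
    have := (h _ (fourierCoeff F) (hsub s)).1
    rwa [← hb s] at this
  · refine le_of_tendsto_of_tendsto' (hr.const_mul _) (hn.const_mul b) fun s => ?_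
    have := (h _ (fourierCoeff F) (hsub s)).2
    rwa [← hb s] at this

end ExponentialSystems

/-! ### Gram matrices of exponentials on B. -/

section FiniteSections

open scoped ComplexOrder InnerProductSpace
open Matrix

theorem norm_restrictL2_le_one (B : Set UnitAddCircle) : ‖restrictL2 B‖ ≤ 1 := by
  refine ContinuousLinearMap.opNorm_le_bound _ zero_le_one fun f => ?_
  rw [one_mul]
  exact le_of_sq_le_sq (norm_sq_restrictL2_le B f) (norm_nonneg f)

theorem norm_sq_restrictL2_fourierLp (B : Set UnitAddCircle) (k : ℤ) :
    ‖restrictL2 B (fourierLp 2 k)‖ ^ 2 = circleMeasure.real B := by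
  have h := norm_sq_restrictL2_trigPoly B {k} fun _ => 1
  simpa [trigPoly, Circle.norm_coe] using h

/-- The normalized Gram matrix of the restrictions to `B` of the first `N` exponentials. -/
noncomputable def restrictedGram (B : Set UnitAddCircle) (N : ℕ) : Matrix (Fin N) (Fin N) ℂ :=
  (1 / circleMeasure.real B) •
    Matrix.gram ℂ fun i : Fin N => restrictL2 B (fourierLp 2 ((i : ℕ) : ℤ))

variable {B : Set UnitAddCircle}

theorem restrictedGram_posSemidef (B : Set UnitAddCircle) (N : ℕ) :
    (restrictedGram B N).PosSemidef :=
  (Matrix.posSemidef_gram _ _).smul (by positivity)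

theorem restrictedGram_diag (hB : 0 < circleMeasure.real B) {N : ℕ} (i : Fin N) :
    restrictedGram B N i i = 1 := by
  rw [restrictedGram, Matrix.smul_apply, Matrix.gram_apply, inner_self_eq_norm_sq_to_K,
    ← RCLike.ofReal_pow, norm_sq_restrictL2_fourierLp, Complex.real_smul]
  have : (circleMeasure.real B : ℂ) ≠ 0 := by exact_mod_cast hB.ne'
  push_cast
  exact one_div_mul_cancel this

/-- Undoing the normalization leaves the Gram matrix of the images of an orthonormal system under a
contraction. -/
theorem one_sub_smul_restrictedGram_posSemidef (hB : 0 < circleMeasure.real B) (N : ℕ) :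
    (1 - circleMeasure.real B • restrictedGram B N).PosSemidef := by
  set v : Fin N → Lp ℂ 2 circleMeasure := fun i => fourierLp 2 ((i : ℕ) : ℤ) with hv
  have h1 : Matrix.gram ℂ v = 1 := by
    rw [Matrix.gram_eq_one_iff_orthonormal]
    exact (orthonormal_fourier (T := (1 : ℝ))).comp _ fun i j hij => by
      exact Fin.ext (by exact_mod_cast hij)
  have h2 := Matrix.posSemidef_opNorm_smul_gram_sub_gram v (restrictL2 B)
  rw [h1] at h2
  have e : 1 - circleMeasure.real B • restrictedGram B N =
      (‖restrictL2 B‖ ^ 2 • (1 : Matrix (Fin N) (Fin N) ℂ) - Matrix.gram ℂ (restrictL2 B ∘ v)) +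
        (1 - ‖restrictL2 B‖ ^ 2) • (1 : Matrix (Fin N) (Fin N) ℂ) := by
    have h3 : circleMeasure.real B • restrictedGram B N = Matrix.gram ℂ (restrictL2 B ∘ v) := by
      rw [restrictedGram, smul_smul, mul_one_div_cancel hB.ne', one_smul]
      rfl
    rw [h3]; module
  rw [e]
  refine h2.add (PosSemidef.one.smul ?_)
  have := norm_restrictL2_le_one B
  nlinarith [norm_nonneg (restrictL2 B)]

theorem re_restrictedGram_form {N : ℕ} (x : Fin N → ℂ) :
    (star x ⬝ᵥ (restrictedGram B N *ᵥ x)).re = 1 / circleMeasure.real B *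
      ‖restrictL2 B (∑ i, x i • fourierLp 2 ((i : ℕ) : ℤ))‖ ^ 2 := by
  rw [restrictedGram, Matrix.smul_mulVec, dotProduct_smul, Matrix.star_dotProduct_gram_mulVec,
    Complex.real_smul, Complex.re_ofReal_mul, map_sum]
  simp only [map_smul]
  rw [inner_self_eq_norm_sq_to_K]
  norm_cast

theorem exists_comparableOn_finite_section {ε : ℝ} (hε : 0 < ε) (hε1 : ε < 1)
    (hB : 0 < circleMeasure.real B) {N : ℕ} (hN : 128 / ε ^ 2 ≤ circleMeasure.real B * N) :
    ∃ Λ : Set ℤ, ComparableOn B (ε ^ 2 / 32) (1536 / ε ^ 2) Λ ∧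
      (1 - ε) * circleMeasure.real B * N ≤ countIn Λ (Finset.Ico 0 N) := by
  classical
  obtain ⟨σ, hσ, h⟩ := exists_two_sided_selection hε hε1 hB measureReal_le_one
    (n := Fin N) (by rwa [Fintype.card_fin]) (restrictedGram_posSemidef B N)
    (restrictedGram_diag hB) (one_sub_smul_restrictedGram_posSemidef hB N)
  set e : Fin N → ℤ := fun i => ((i : ℕ) : ℤ) with he
  have hinj : Function.Injective e := fun i j hij => Fin.ext (Int.ofNat_inj.1 hij)
  refine ⟨↑(σ.image e), ?_, ?_⟩
  · intro s c hs
    set x : Fin N → ℂ := fun i => if e i ∈ s then c (e i) else 0 with hx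
    have hes : s = (Finset.univ.filter fun i => e i ∈ s).image e := by
      ext z
      simp only [Finset.mem_image, Finset.mem_filter, Finset.mem_univ, true_and]
      constructor
      · intro hz
        have := hs hz
        rw [Finset.mem_coe, Finset.mem_image] at this
        obtain ⟨i, -, rfl⟩ := this
        exact ⟨i, hz, rfl⟩
      · rintro ⟨i, hi, rfl⟩; exact hi
    have hx0 : ∀ i, i ∉ σ → x i = 0 := by
      intro i hi
      rw [hx]
      simp only [ite_eq_right_iff]
      intro his
      have := hs his
      rw [Finset.mem_coe, Finset.mem_image] at this
      obtain ⟨j, hj, hji⟩ := this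
      exact absurd (hinj hji ▸ hj) hi
    have hp : ∑ i, x i • fourierLp (T := (1 : ℝ)) 2 (e i) = trigPoly s c := by
      unfold trigPoly
      conv_rhs => rw [hes]
      rw [Finset.sum_image hinj.injOn, Finset.sum_filter]
      refine Finset.sum_congr rfl fun i _ => ?_
      by_cases hi : e i ∈ s <;> simp [hx, hi]
    have hn : (star x ⬝ᵥ x).re = ‖trigPoly s c‖ ^ 2 := by
      rw [norm_sq_trigPoly]
      conv_rhs => rw [hes]
      rw [Finset.sum_image hinj.injOn, Finset.sum_filter, dotProduct, Complex.re_sum]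
      refine Finset.sum_congr rfl fun i _ => ?_
      by_cases hi : e i ∈ s
      · simp only [hx, hi, if_true, Pi.star_apply, RCLike.star_def, Complex.conj_mul']
        norm_cast
      · simp [hx, hi]
    have := h x hx0
    rwa [re_restrictedGram_form, hp, hn] at this
  · have hc : countIn ↑(σ.image e) (Finset.Ico 0 N) = σ.card := by
      unfold countIn
      rw [← Finset.card_image_of_injective σ hinj]
      congr 1
      ext z
      simp only [Finset.mem_filter, Finset.mem_Ico, Finset.mem_coe]
      refine ⟨fun h => h.2, fun h => ⟨?_, h⟩⟩
      rw [Finset.mem_image] at h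
      obtain ⟨i, -, rfl⟩ := h
      have := i.2
      simp only [he]
      omega
    rw [hc, mul_assoc]
    rwa [Fintype.card_fin] at hσ

theorem exists_comparableOn_hasTwoSidedDensity {ε : ℝ} (hε : 0 < ε) (hε1 : ε < 1)
    (hB : 0 < circleMeasure.real B) :
    ∃ (Λ : Set ℤ) (d : ℝ), ComparableOn B (ε ^ 2 / 32) (1536 / ε ^ 2) Λ ∧
      HasTwoSidedDensity Λ d ∧ (1 - ε) * circleMeasure.real B ≤ d := by
  apply exists_hasTwoSidedDensity (𝒜 := ComparableOn B (ε ^ 2 / 32) (1536 / ε ^ 2))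
  · exact fun Λ Λ' h h' => h.mono h'
  · exact fun Λ j h => h.shift j
  · exact fun Λ h => comparableOn_of_finset h
  · obtain ⟨N₀, hN₀⟩ := exists_nat_ge (128 / ε ^ 2 / circleMeasure.real B)
    filter_upwards [eventually_ge_atTop N₀] with N hN
    apply exists_comparableOn_finite_section hε hε1 hB
    rw [div_le_iff₀ hB] at hN₀
    have : (N₀ : ℝ) ≤ N := by exact_mod_cast hN
    nlinarith

end FiniteSections

/-! ### Translation to the stated norms and conclusion. -/

theorem normL2Circle_eq_norm {f : UnitAddCircle → ℂ} (hf : MemLp f 2 circleMeasure) :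
    normL2Circle f = ‖hf.toLp f‖ := by
  rw [normL2Circle, ← Real.sqrt_sq (norm_nonneg (hf.toLp f)), norm_sq_Lp_eq_integral]
  congr 1
  apply integral_congr_ae
  filter_upwards [hf.coeFn_toLp] with t ht
  rw [ht]

theorem normL2On_eq_sqrt (B : Set UnitAddCircle) {f : UnitAddCircle → ℂ}
    (hf : MemLp f 2 circleMeasure) :
    normL2On B f = Real.sqrt (1 / circleMeasure.real B * ‖restrictL2 B (hf.toLp f)‖ ^ 2) := by
  rw [normL2On, norm_sq_restrictL2]
  congr 2
  apply integral_congr_ae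
  filter_upwards [ae_restrict_of_ae hf.coeFn_toLp] with t ht
  rw [ht]

theorem mainTheorem5 (ε : ℝ) (hε : 0 < ε) :
    ∃ c₁ c₂ : ℝ, 0 < c₁ ∧ 0 < c₂ ∧
      ∀ B : Set UnitAddCircle, NullMeasurableSet B circleMeasure → 0 < circleMeasure B →
        ∃ (Λ : Set ℤ) (d : ℝ),
          HasTwoSidedDensity Λ d ∧ (1 - ε) * circleMeasure.real B < d ∧
          ∀ f : UnitAddCircle → ℂ, MemLp f 2 circleMeasure → FourierSupportedBy f Λ →
            c₁ * normL2Circle f ≤ normL2On B f ∧ normL2On B f ≤ c₂ * normL2Circle f := by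
  -- Taking δ < ε turns the weak density bound into a strict one, since ν(B) > 0; δ < 1 is needed
  -- for the selection.
  obtain ⟨δ, hδ0, hδε, hδ1⟩ : ∃ δ : ℝ, 0 < δ ∧ δ < ε ∧ δ < 1 :=
    ⟨min ε 1 / 2, by positivity, by linarith [min_le_left ε 1], by linarith [min_le_right ε 1]⟩
  have ha : 0 < δ ^ 2 / 32 := by positivity
  have hb : 0 < 1536 / δ ^ 2 := by positivity
  refine ⟨Real.sqrt (δ ^ 2 / 32), Real.sqrt (1536 / δ ^ 2), Real.sqrt_pos.2 ha,
    Real.sqrt_pos.2 hb, fun B _ hB => ?_⟩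
  have hB' : 0 < circleMeasure.real B := ENNReal.toReal_pos hB.ne' (measure_ne_top _ _)
  obtain ⟨Λ, d, hΛ, hd, hle⟩ := exists_comparableOn_hasTwoSidedDensity hδ0 hδ1 hB'
  refine ⟨Λ, d, hd, lt_of_lt_of_le (by nlinarith) hle, fun f hf hs => ?_⟩
  obtain ⟨h1, h2⟩ := hΛ.norm_sq_bounds (hf.toLp f) fun k hk => by
    rw [fourierCoeff_congr_ae hf.coeFn_toLp]; exact hs k hk
  rw [normL2Circle_eq_norm hf, normL2On_eq_sqrt B hf, ← Real.sqrt_sq (norm_nonneg (hf.toLp f)),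
    ← Real.sqrt_mul ha.le, ← Real.sqrt_mul hb.le]
  exact ⟨Real.sqrt_le_sqrt h1, Real.sqrt_le_sqrt h2⟩
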